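/- Let $N\ge 2$ and let $U$ be a unitary operator on $\mathbb C^N\otimes\mathbb C^N$. Let $\sqrt U$ be its principal square root, i.e. the unitary with the same eigenvectors as $U$ and with eigenvalue $e^{i\varphi/2}$ where $U$ has the eigenvalue $e^{i\varphi}$, $-\pi<\varphi\le\pi$. For a unitary $V$ on $\mathbb C^N\otimes\mathbb C^N$ define the following quantities. (a) The entangling power $e_p(V)$ is the average of $E_L(V|\psi_A\rangle|\psi_B\rangle)$ over independent unit vectors $\psi_A,\psi_B\in\mathbb C^N$, each distributed according to the unitarily invariant probability measure on the unit sphere. Here $E_L(\chi)=1-\operatorname{tr}\rho_A^2$, with $\rho_A=\operatorname{tr}_B|\chi\rangle\langle\chi|$, is the linear entropy. Let $\overline{e_p}$ denote the mean of $e_p$ over the Haar probability measure of $U(N^2)$. (b) The operator entanglement is $E(V)=1-\frac1{N^4}\sum_{i=1}^{N^2}\lambda_i^2$, where $V=\sum_{i=1}^{N^2}\sqrt{\lambda_i}\,A_i\otimes B_i$ is an operator Schmidt decomposition: $\lambda_i\ge0$, $\operatorname{tr}(A_iA_j^\dagger)=\operatorname{tr}(B_iB_j^\dagger)=\delta_{ij}$.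 With the swap gate $S|\psi_A\rangle|\psi_B\rangle=|\psi_B\rangle|\psi_A\rangle$, the gate-typicality is $$g_t(V)=\frac{N^2}{N^2-1}\bigl[E(V)-E(VS)+E(S)\bigr].$$ Then the following hold. 1. If $e_p(U)<e_p(\sqrt U)\,\bigl(2-e_p(\sqrt U)/\overline{e_p}\bigr)$, then there exist unitaries $U^A,U^B\in U(N)$ such that $e_p(U)<e_p\bigl(\sqrt U\,(U^A\otimes U^B)\,\sqrt U\bigr)$. 2. If $g_t(U)<g_t(\sqrt U)\,\bigl(2-g_t(\sqrt U)\bigr)$, then there exist unitaries $U^A,U^B\in U(N)$ such that $g_t(U)<g_t\bigl(\sqrt U\,(U^A\otimes U^B)\,\sqrt U\bigr)$. -/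

import Mathlib

open Matrix MeasureTheory
open scoped Kronecker

namespace BipartiteGate

/-- Operators on `ℂ^N ⊗ ℂ^N`, in the product basis `|i⟩|j⟩ = (i, j)`. -/
abbrev BipartiteMatrix (N : ℕ) : Type := Matrix (Fin N × Fin N) (Fin N × Fin N) ℂ

/-! ### Linear entropy and entangling power -/

/-- The product state `|ψ_A⟩|ψ_B⟩`. -/
def productState {N : ℕ} (a b : EuclideanSpace ℂ (Fin N)) : Fin N × Fin N → ℂ :=
  fun p => a p.1 * b p.2

/-- Partial trace over the second subsystem. -/
def partialTraceB {N : ℕ} (ρ : BipartiteMatrix N) : Matrix (Fin N) (Fin N) ℂ :=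
  Matrix.of fun i j => ∑ k, ρ (i, k) (j, k)

/-- The reduced density matrix `ρ_A` of the vector `φ`, i.e. the partial trace of `|φ⟩⟨φ|`. -/
def reducedDensity {N : ℕ} (φ : Fin N × Fin N → ℂ) : Matrix (Fin N) (Fin N) ℂ :=
  partialTraceB (vecMulVec φ (star φ))

/-- The linear entropy `E_L = 1 - tr ρ_A²` (the trace is real since `ρ_A` is Hermitian). -/
noncomputable def linearEntropy {N : ℕ} (φ : Fin N × Fin N → ℂ) : ℝ :=
  1 - (reducedDensity φ * reducedDensity φ).trace.re

/-- The entangling power: the average of `E_L (U |ψ_A⟩|ψ_B⟩)` over independent `ψ_A`, `ψ_B`,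
each distributed according to the normalized surface measure of the unit sphere of `ℂ^N`,
the unitarily invariant probability measure there
(`⨍` is the integral divided by the total mass of the measure). -/
noncomputable def entanglingPower {N : ℕ} (U : BipartiteMatrix N) : ℝ :=
  ⨍ a : Metric.sphere (0 : EuclideanSpace ℂ (Fin N)) 1,
    (⨍ b : Metric.sphere (0 : EuclideanSpace ℂ (Fin N)) 1,
      linearEntropy (U *ᵥ productState (a : EuclideanSpace ℂ (Fin N)) b)
      ∂(volume : Measure (EuclideanSpace ℂ (Fin N))).toSphere)
    ∂(volume : Measure (EuclideanSpace ℂ (Fin N))).toSphere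

/-! ### Haar measure on the unitary group and the mean entangling power -/

noncomputable instance instMeasurableSpaceUnitaryGroup {n : Type*} [Fintype n] [DecidableEq n] :
    MeasurableSpace (Matrix.unitaryGroup n ℂ) := borel _

instance instBorelSpaceUnitaryGroup {n : Type*} [Fintype n] [DecidableEq n] :
    BorelSpace (Matrix.unitaryGroup n ℂ) := ⟨rfl⟩

instance instCompactSpaceUnitaryGroup {n : Type*} [Fintype n] [DecidableEq n] :
    CompactSpace (Matrix.unitaryGroup n ℂ) := by
  refine (isCompact_iff_compactSpace (s := (Matrix.unitaryGroup n ℂ : Set (Matrix n n ℂ)))).mp ?_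
  have hK : IsCompact {M : Matrix n n ℂ |
      ∀ i, M i ∈ {r : n → ℂ | ∀ j, r j ∈ Metric.closedBall (0 : ℂ) 1}} :=
    isCompact_pi_infinite fun _ => isCompact_pi_infinite fun _ => isCompact_closedBall (0 : ℂ) 1
  refine hK.of_isClosed_subset ?_ ?_
  · have : ((Matrix.unitaryGroup n ℂ : Submonoid (Matrix n n ℂ)) : Set (Matrix n n ℂ)) =
        {M | M * star M = 1} := by
      ext M
      exact Matrix.mem_unitaryGroup_iff
    rw [this]
    exact isClosed_eq (by fun_prop) continuous_const
  · intro M hM i j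
    simpa using entry_norm_bound_of_unitary hM i j

/-- The Haar probability measure on the unitary group. -/
noncomputable def haarUnitary (n : Type*) [Fintype n] [DecidableEq n] :
    Measure (Matrix.unitaryGroup n ℂ) :=
  Measure.haarMeasure ⊤

/-- The mean entangling power over Haar distributed gates in `U(N²)`. -/
noncomputable def meanEntanglingPower (N : ℕ) : ℝ :=
  ∫ U, entanglingPower (U : BipartiteMatrix N) ∂(haarUnitary (Fin N × Fin N))

/-! ### Operator Schmidt decomposition, operator entanglement, gate-typicality -/

/-- `U = ∑ i, √λ_i A_i ⊗ B_i` is an operator Schmidt decomposition of `U`: `λ_i ≥ 0` and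
`A_i`, `B_i` are orthonormal for the Hilbert-Schmidt inner product. -/
structure IsOperatorSchmidt {N : ℕ} (U : BipartiteMatrix N) (l : Fin (N ^ 2) → ℝ)
    (A B : Fin (N ^ 2) → Matrix (Fin N) (Fin N) ℂ) : Prop where
  nonneg : ∀ i, 0 ≤ l i
  orthonormal_left : ∀ i j, (A i * (A j)ᴴ).trace = if i = j then 1 else 0
  orthonormal_right : ∀ i j, (B i * (B j)ᴴ).trace = if i = j then 1 else 0
  eq_sum : U = ∑ i, ((Real.sqrt (l i) : ℝ) : ℂ) • (A i ⊗ₖ B i)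

theorem trace_mul_conjTranspose_eq_sum {N : ℕ} (A B : Matrix (Fin N) (Fin N) ℂ) :
    (A * Bᴴ).trace = ∑ p : Fin N × Fin N, A p.1 p.2 * star (B p.1 p.2) := by
  simp [Matrix.trace, Matrix.mul_apply, Fintype.sum_prod_type]

/-- A singular value decomposition, entrywise. -/
theorem exists_singular_decomposition {m : Type*} [Fintype m] [DecidableEq m] {d : ℕ}
    (hd : Fintype.card m = d) (M : Matrix m m ℂ) :
    ∃ (s : Fin d → ℝ) (u v : Fin d → m → ℂ), (∀ i, 0 ≤ s i) ∧
      (∀ i j, ∑ p, u i p * star (u j p) = if i = j then 1 else 0) ∧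
      (∀ i j, ∑ p, v i p * star (v j p) = if i = j then 1 else 0) ∧
      ∀ p q, M p q = ∑ i, (s i : ℂ) * (u i p * v i q) := by
  have hfr : Module.finrank ℂ (EuclideanSpace ℂ m) = d := by simp [hd]
  have hfr' : Module.finrank ℂ (EuclideanSpace ℂ m) = Fintype.card (Fin d) := by simp [hd]
  set T := Matrix.toEuclideanLin M with hT
  have hsym : (LinearMap.adjoint T ∘ₗ T).IsSymmetric := T.isSymmetric_adjoint_mul_self
  set e := hsym.eigenvectorBasis hfr with he
  set f : Fin d → EuclideanSpace ℂ m := fun i => T (e i) with hf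
  have horth : Pairwise fun i j => inner ℂ (f i) (f j) = 0 := by
    intro i j hij
    have h1 : inner ℂ (f i) (f j) = inner ℂ (e i) ((LinearMap.adjoint T ∘ₗ T) (e j)) := by
      simp [hf, LinearMap.adjoint_inner_right]
    rw [h1, he, hsym.apply_eigenvectorBasis, inner_smul_right, orthonormal_iff_ite.1 e.orthonormal]
    simp [hij]
  set b := InnerProductSpace.gramSchmidtOrthonormalBasis hfr' f with hb
  have hfb : ∀ i, f i = ((‖f i‖ : ℝ) : ℂ) • b i := by
    intro i
    by_cases h0 : f i = 0
    · simp [h0]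
    · rw [hb, InnerProductSpace.gramSchmidtOrthonormalBasis_apply_of_orthogonal hfr' horth h0,
        smul_smul]
      have : ((‖f i‖ : ℝ) : ℂ) ≠ 0 := by simpa using h0
      simp [this]
  refine ⟨fun i => ‖f i‖, fun i p => b i p, fun i q => star (e i q), fun i => norm_nonneg _,
    ?_, ?_, ?_⟩
  · intro i j
    have := orthonormal_iff_ite.1 b.orthonormal j i
    simp only [PiLp.inner_apply, RCLike.inner_apply] at this
    simpa [eq_comm] using this
  · intro i j
    have := orthonormal_iff_ite.1 e.orthonormal i j
    simp only [PiLp.inner_apply, RCLike.inner_apply] at this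
    rw [← this]
    exact Finset.sum_congr rfl fun p _ => by simp [mul_comm]
  · intro p q
    have h1 : M p q = T (EuclideanSpace.single q 1) p := by
      simp [hT, Matrix.toLpLin_apply]
    rw [h1, ← e.sum_repr' (EuclideanSpace.single q 1), map_sum]
    simp only [map_smul]
    rw [WithLp.ofLp_sum, Finset.sum_apply]
    refine Finset.sum_congr rfl fun i _ => ?_
    have h2 : T (e i) = ((‖f i‖ : ℝ) : ℂ) • b i := hfb i
    rw [h2]
    simp [EuclideanSpace.inner_single_right]
    ring

/-- Every operator has an operator Schmidt decomposition. -/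
theorem exists_isOperatorSchmidt {N : ℕ} (U : BipartiteMatrix N) :
    ∃ l A B, IsOperatorSchmidt U l A B := by
  obtain ⟨s, u, v, hs, hu, hv, hM⟩ := exists_singular_decomposition (d := N ^ 2)
    (by simp [sq]) (Matrix.of fun p q : Fin N × Fin N => U (p.1, q.1) (p.2, q.2))
  refine ⟨fun i => s i ^ 2, fun i => Matrix.of fun a c => u i (a, c),
    fun i => Matrix.of fun a c => v i (a, c), fun i => sq_nonneg _, ?_, ?_, ?_⟩
  · intro i j
    rw [trace_mul_conjTranspose_eq_sum]
    exact hu i j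
  · intro i j
    rw [trace_mul_conjTranspose_eq_sum]
    exact hv i j
  · ext ⟨a, b⟩ ⟨c, d⟩
    have := hM (a, c) (b, d)
    simp only [Matrix.of_apply] at this
    rw [this, Matrix.sum_apply]
    exact Finset.sum_congr rfl fun i _ => by
      simp [Real.sqrt_sq (hs i), Matrix.kroneckerMap_apply]

/-- The coefficients `λ_i` of an operator Schmidt decomposition of `U`. -/
noncomputable def schmidtCoeff {N : ℕ} (U : BipartiteMatrix N) : Fin (N ^ 2) → ℝ :=
  (exists_isOperatorSchmidt U).choose

/-- The operator entanglement `E(U) = 1 - N⁻⁴ ∑ λ_i²`. It does not depend on the choice of the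
decomposition, see `IsOperatorSchmidt.opEntanglement_eq`. -/
noncomputable def opEntanglement {N : ℕ} (U : BipartiteMatrix N) : ℝ :=
  1 - 1 / (N : ℝ) ^ 4 * ∑ i, schmidtCoeff U i ^ 2

/-- The sum of the squared Schmidt coefficients in terms of the reshuffled matrix. -/
theorem IsOperatorSchmidt.sum_sq_eq {N : ℕ} {U : BipartiteMatrix N} {l : Fin (N ^ 2) → ℝ}
    {A B : Fin (N ^ 2) → Matrix (Fin N) (Fin N) ℂ} (h : IsOperatorSchmidt U l A B)
    {R : BipartiteMatrix N} (hR : R = Matrix.of fun p q => U (p.1, q.1) (p.2, q.2)) :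
    ((∑ i, l i ^ 2 : ℝ) : ℂ) = ((R * Rᴴ) * (R * Rᴴ)).trace := by
  set P : Matrix (Fin N × Fin N) (Fin (N ^ 2)) ℂ := Matrix.of fun p i => A i p.1 p.2 with hP
  set Q : Matrix (Fin (N ^ 2)) (Fin N × Fin N) ℂ := Matrix.of fun i p => B i p.1 p.2 with hQ
  set D : Matrix (Fin (N ^ 2)) (Fin (N ^ 2)) ℂ :=
    Matrix.diagonal fun i => ((Real.sqrt (l i) : ℝ) : ℂ) with hD
  have hPP : Pᴴ * P = 1 := by
    ext i j
    have := h.orthonormal_left j i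
    rw [trace_mul_conjTranspose_eq_sum] at this
    rw [Matrix.mul_apply, Matrix.one_apply]
    simp only [hP, Matrix.conjTranspose_apply, Matrix.of_apply, eq_comm (a := i)]
    rw [← this]
    exact Finset.sum_congr rfl fun p _ => mul_comm _ _
  have hQQ : Q * Qᴴ = 1 := by
    ext i j
    have := h.orthonormal_right i j
    rw [trace_mul_conjTranspose_eq_sum] at this
    rw [Matrix.mul_apply, Matrix.one_apply]
    exact this
  have hDD : D * Dᴴ = Matrix.diagonal fun i => (l i : ℂ) := by
    rw [hD, Matrix.diagonal_conjTranspose, Matrix.diagonal_mul_diagonal]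
    congr 1
    ext i
    simp only [Pi.star_apply, RCLike.star_def, Complex.conj_ofReal]
    rw [← Complex.ofReal_mul, Real.mul_self_sqrt (h.nonneg i)]
  have hRR : R = P * D * Q := by
    ext ⟨a, c⟩ ⟨b, d⟩
    rw [hR, Matrix.mul_apply]
    simp only [hD, Matrix.mul_diagonal, Matrix.of_apply]
    rw [h.eq_sum, Matrix.sum_apply]
    exact Finset.sum_congr rfl fun i _ => by
      simp only [Matrix.smul_apply, Matrix.kroneckerMap_apply, smul_eq_mul, hP, hQ,
        Matrix.of_apply]
      ring
  have h1 : R * Rᴴ = P * (D * Dᴴ) * Pᴴ := by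
    rw [hRR, Matrix.conjTranspose_mul, Matrix.conjTranspose_mul]
    calc P * D * Q * (Qᴴ * (Dᴴ * Pᴴ)) = P * D * (Q * Qᴴ) * Dᴴ * Pᴴ := by
          simp only [Matrix.mul_assoc]
      _ = _ := by rw [hQQ]; simp only [Matrix.mul_assoc, Matrix.one_mul]
  have h2 : (R * Rᴴ) * (R * Rᴴ) = P * ((D * Dᴴ) * (D * Dᴴ)) * Pᴴ := by
    rw [h1]
    calc P * (D * Dᴴ) * Pᴴ * (P * (D * Dᴴ) * Pᴴ)
        = P * (D * Dᴴ) * (Pᴴ * P) * (D * Dᴴ) * Pᴴ := by simp only [Matrix.mul_assoc]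
      _ = _ := by rw [hPP]; simp only [Matrix.mul_assoc, Matrix.one_mul]
  rw [h2, Matrix.trace_mul_comm, ← Matrix.mul_assoc, hPP, Matrix.one_mul, hDD,
    Matrix.diagonal_mul_diagonal, Matrix.trace_diagonal]
  push_cast
  exact Finset.sum_congr rfl fun i _ => by ring

/-- The operator entanglement can be computed from any operator Schmidt decomposition. -/
theorem IsOperatorSchmidt.opEntanglement_eq {N : ℕ} {U : BipartiteMatrix N}
    {l : Fin (N ^ 2) → ℝ} {A B : Fin (N ^ 2) → Matrix (Fin N) (Fin N) ℂ}
    (h : IsOperatorSchmidt U l A B) :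
    opEntanglement U = 1 - 1 / (N : ℝ) ^ 4 * ∑ i, l i ^ 2 := by
  obtain ⟨A', B', h'⟩ := (exists_isOperatorSchmidt U).choose_spec
  have h1 := (h'.sum_sq_eq rfl).trans (h.sum_sq_eq rfl).symm
  rw [opEntanglement, schmidtCoeff, Complex.ofReal_injective h1]

/-- The swap gate `S |ψ_A⟩|ψ_B⟩ = |ψ_B⟩|ψ_A⟩`. -/
def swapGate (N : ℕ) : BipartiteMatrix N :=
  Matrix.of fun p q => if p.1 = q.2 ∧ p.2 = q.1 then 1 else 0

/-- The gate-typicality `g_t(U) = N²/(N²-1) [E(U) - E(US) + E(S)]`. -/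
noncomputable def gateTypicality {N : ℕ} (U : BipartiteMatrix N) : ℝ :=
  (N : ℝ) ^ 2 / ((N : ℝ) ^ 2 - 1) *
    (opEntanglement U - opEntanglement (U * swapGate N) + opEntanglement (swapGate N))

/-! ### The principal square root of a unitary and local gates -/

section PrincipalSqrt

open scoped Matrix.Norms.L2Operator

/-- The principal square root of a unitary matrix `U`: it has the eigenvectors of `U`, with
eigenvalue `exp (i φ / 2)` where that of `U` is `exp (i φ)`, `-π < φ ≤ π`
(`z ^ (1 / 2)` is the principal branch, with argument in `(-π/2, π/2]`). -/
noncomputable def principalSqrt {n : Type*} [Fintype n] [DecidableEq n]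
    (U : Matrix.unitaryGroup n ℂ) : Matrix.unitaryGroup n ℂ :=
  ⟨cfc (fun z : ℂ => z ^ (1 / 2 : ℂ)) (U : Matrix n n ℂ), by
    have hcont : ContinuousOn (fun z : ℂ => z ^ (1 / 2 : ℂ))
        (spectrum ℂ (U : Matrix n n ℂ)) := by
      rw [continuousOn_iff_continuous_domRestrict]
      have : Finite (spectrum ℂ (U : Matrix n n ℂ)) :=
        (Matrix.finite_spectrum (U : Matrix n n ℂ)).to_subtype
      exact continuous_of_discreteTopology
    have hU : (U : Matrix n n ℂ) ∈ unitary (Matrix n n ℂ) := U.2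
    have hnorm : IsStarNormal (U : Matrix n n ℂ) :=
      ⟨by rw [commute_iff_eq, Unitary.star_mul_self_of_mem hU, Unitary.mul_star_self_of_mem hU]⟩
    refine (cfc_unitary_iff (fun z : ℂ => z ^ (1 / 2 : ℂ)) (U : Matrix n n ℂ) hnorm hcont).2 ?_
    intro x hx
    have hx1 : ‖x‖ = 1 := by
      simpa using spectrum.subset_circle_of_unitary hU hx
    have hx0 : x ≠ 0 := by
      rintro rfl
      simp at hx1
    have h2 : ‖x ^ (1 / 2 : ℂ)‖ = 1 := by
      rw [Complex.norm_cpow_of_ne_zero hx0, hx1]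
      simp
    rw [RCLike.star_def, Complex.conj_mul', h2]
    simp⟩

end PrincipalSqrt

/-- The local gate `U^A ⊗ U^B`. -/
def localGate {N : ℕ} (UA UB : Matrix.unitaryGroup (Fin N) ℂ) : BipartiteMatrix N :=
  (UA : Matrix (Fin N) (Fin N) ℂ) ⊗ₖ (UB : Matrix (Fin N) (Fin N) ℂ)

end BipartiteGate

open BipartiteGate

/-! Both quantities are transition weights between symmetry types of two copies. Let `twoCopy V` be
V ⊗ V with factors ordered A A B B, and let P_s be the symmetric (+) or antisymmetric (−)
projection, of rank d_s. Then e_p(V) = 2 tr(V₂ P₊₊ V₂ᴴ P₋₋)/d₊² and g_t(V) = 2 tr(V₂ P₊₋ V₂ᴴ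
P₋₊)/(d₊ d₋), where P_st = P_s ⊗ P_t.

V₂ commutes with the exchange of the two copies, so the sectors {++, −−} and {+−, −+} do not mix
(`overlap_biProj_eq_zero`). Inside a sector the weights form a 2×2 table whose row and column sums
are the ranks D, D' of its two projections (`overlap_row`, `overlap_column`), leaving one free
number x.

Averaging over Haar random u ⊗ v projects onto the span of the P_st, because the commutant of all u
⊗ u is spanned by 1 and the flip (`commutant_kronecker_self`). Hence the average over local gates of
the weight of W (u ⊗ v) W is a product of two tables, equal to x (2 − x (1/D + 1/D'))
(`integral_overlap_local`). After normalization this is e_p(W) (2 − e_p(W)/mean), respectively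
g_t(W) (2 − g_t(W)). Some local gate does at least as well as the average, and with W = √U the
hypothesis places that average above the value at U. -/

/-! ### The commutant of the operators u ⊗ u. -/

section Commutant

variable {n : Type*} [DecidableEq n]

/-- The permutation matrix exchanging the two factors of `ℂ^n ⊗ ℂ^n`. -/
def flipMatrix (n : Type*) [DecidableEq n] : Matrix (n × n) (n × n) ℂ :=
  Matrix.of fun p q => if p = q.swap then 1 else 0

theorem flipMatrix_apply (p q : n × n) : flipMatrix n p q = if p = q.swap then 1 else 0 := rfl

theorem flipMatrix_conjTranspose : (flipMatrix n)ᴴ = flipMatrix n := by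
  ext p q
  rw [Matrix.conjTranspose_apply, flipMatrix_apply, flipMatrix_apply]
  have : q = p.swap ↔ p = q.swap := by
    constructor <;> (rintro rfl; simp)
  simp only [this]
  split_ifs <;> simp

variable [Fintype n]

theorem mul_flipMatrix_apply {m : Type*} (M : Matrix m (n × n) ℂ) (p : m) (q : n × n) :
    (M * flipMatrix n) p q = M p q.swap := by
  simp [Matrix.mul_apply, flipMatrix_apply]

theorem flipMatrix_mul_apply {m : Type*} (M : Matrix (n × n) m ℂ) (p : n × n) (q : m) :
    (flipMatrix n * M) p q = M p.swap q := by
  rw [Matrix.mul_apply, Finset.sum_eq_single p.swap]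
  · simp [flipMatrix_apply]
  · intro b _ hb
    rw [flipMatrix_apply, if_neg, zero_mul]
    rintro rfl
    simp at hb
  · simp

theorem flipMatrix_mul_self : flipMatrix n * flipMatrix n = 1 := by
  ext p q
  rw [mul_flipMatrix_apply, flipMatrix_apply, Prod.swap_swap, Matrix.one_apply]

theorem flipMatrix_trace : (flipMatrix n).trace = Fintype.card n := by
  rw [Matrix.trace, Fintype.sum_prod_type]
  simp only [Matrix.diag_apply, flipMatrix_apply, Prod.swap_prod_mk, Prod.mk.injEq]
  have : ∀ x y : n, (if x = y ∧ y = x then (1 : ℂ) else 0) = if x = y then 1 else 0 := by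
    intro x y
    congr 1
    simp only [eq_comm (a := y), and_self]
  simp [this]

theorem kronecker_self_commute_flipMatrix (A : Matrix n n ℂ) :
    (A ⊗ₖ A) * flipMatrix n = flipMatrix n * (A ⊗ₖ A) := by
  ext p q
  rw [mul_flipMatrix_apply, flipMatrix_mul_apply]
  simp [Matrix.kroneckerMap_apply, mul_comm]

theorem diagonal_mem_unitaryGroup {z : n → ℂ} (hz : ∀ i, z i * star (z i) = 1) :
    Matrix.diagonal z ∈ Matrix.unitaryGroup n ℂ := by
  rw [Matrix.mem_unitaryGroup_iff, Matrix.star_eq_conjTranspose, Matrix.diagonal_conjTranspose,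
    Matrix.diagonal_mul_diagonal, ← Matrix.diagonal_one]
  congr 1
  ext i
  exact hz i

theorem permMatrix_mem_unitaryGroup (σ : Equiv.Perm n) :
    σ.permMatrix ℂ ∈ Matrix.unitaryGroup n ℂ := by
  rw [Matrix.mem_unitaryGroup_iff, Matrix.star_eq_conjTranspose, Matrix.conjTranspose_permMatrix,
    ← Matrix.permMatrix_mul]
  simp

/-- A unitary with two nonzero entries in one row. -/
theorem exists_unitary_mixing {x y : n} (hxy : x ≠ y) :
    ∃ u ∈ Matrix.unitaryGroup n ℂ, u x x ≠ 0 ∧ u x y ≠ 0 := by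
  set v : n → ℂ := Pi.single x 1 + Pi.single y 1 with hv
  set J : Matrix n n ℂ := vecMulVec v (star v) with hJ
  -- Since J² = 2J, the matrix 1 + kJ multiplies v by 1 + 2k = i and fixes the orthogonal complement
  -- of v, so it is unitary.
  set k : ℂ := (Complex.I - 1) / 2 with hk
  have hvv : star v ⬝ᵥ v = 2 := by
    simp [hv, dotProduct_add, hxy, hxy.symm]
    norm_num
  have hJJ : J * J = (2 : ℂ) • J := by
    rw [hJ, Matrix.vecMulVec_mul_vecMulVec, hvv, Matrix.vecMulVec_smul]
  have hJs : star J = J := by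
    rw [Matrix.star_eq_conjTranspose, hJ, Matrix.conjTranspose_vecMulVec, star_star]
  have hkk : k + star k + 2 * (k * star k) = 0 := by
    apply Complex.ext <;> simp [hk] <;> norm_num
  refine ⟨1 + k • J, ?_, ?_, ?_⟩
  · rw [Matrix.mem_unitaryGroup_iff, star_add, star_smul, hJs, star_one]
    have : (1 + k • J) * (1 + star k • J) = 1 + (k + star k + 2 * (k * star k)) • J := by
      rw [add_mul, mul_add, mul_add, smul_mul_smul_comm, hJJ]
      simp only [one_mul, mul_one, smul_smul, add_smul]
      rw [mul_comm (k * star k) 2]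
      abel
    rw [this, hkk, zero_smul, add_zero]
  · have : (1 + k • J) x x = (1 + Complex.I) / 2 := by
      simp [hJ, hv, vecMulVec_apply, hxy, hk]
      ring
    rw [this]
    intro h
    have := congrArg Complex.re h
    norm_num at this
  · have : (1 + k • J) x y = (Complex.I - 1) / 2 := by
      simp [hJ, hv, vecMulVec_apply, hxy, hxy.symm, hk]
    rw [this]
    intro h
    have := congrArg Complex.re h
    norm_num at this

/-- An operator on `ℂ^n ⊗ ℂ^n` commuting with every `u ⊗ u` is a combination of the identity
and the flip. -/
theorem commutant_kronecker_self [Nontrivial n] {X : Matrix (n × n) (n × n) ℂ}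
    (hX : ∀ u ∈ Matrix.unitaryGroup n ℂ, (u ⊗ₖ u) * X = X * (u ⊗ₖ u)) :
    ∃ b c : ℂ, X = b • 1 + c • flipMatrix n := by
  have hdiag : ∀ z : n → ℂ, (∀ i, z i * star (z i) = 1) → ∀ p q,
      z p.1 * z p.2 * X p q = X p q * (z q.1 * z q.2) := by
    intro z hz p q
    have h := congrFun (congrFun (hX _ (diagonal_mem_unitaryGroup hz)) p) q
    rw [Matrix.diagonal_kronecker_diagonal, Matrix.diagonal_mul, Matrix.mul_diagonal] at h
    exact h
  have hperm : ∀ (σ : Equiv.Perm n) (p q : n × n),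
      X (σ p.1, σ p.2) (σ q.1, σ q.2) = X p q := by
    intro σ p q
    have h := congrFun (congrFun (hX _ (permMatrix_mem_unitaryGroup σ)) p) (σ q.1, σ q.2)
    rw [Matrix.mul_apply, Matrix.mul_apply, Finset.sum_eq_single (σ p.1, σ p.2),
      Finset.sum_eq_single q] at h
    · simpa [Equiv.Perm.permMatrix, Matrix.kroneckerMap_apply, PEquiv.toMatrix_apply] using h
    · intro r _ hr
      simp only [Equiv.Perm.permMatrix, Matrix.kroneckerMap_apply, PEquiv.toMatrix_apply]
      by_cases h1 : r.1 = q.1 <;> by_cases h2 : r.2 = q.2 <;> simp [h1, h2]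
      exact absurd (Prod.ext h1 h2) hr
    · simp
    · intro r _ hr
      simp only [Equiv.Perm.permMatrix, Matrix.kroneckerMap_apply, PEquiv.toMatrix_apply]
      by_cases h1 : σ p.1 = r.1 <;> by_cases h2 : σ p.2 = r.2 <;> simp [h1, h2]
      exact absurd (Prod.ext h1.symm h2.symm) hr
    · simp
  -- Put the phase i at one site m and 1 elsewhere. The products 1, i, −1 count how often m occurs
  -- in a pair, so a nonzero entry forces p and q to be the same pair up to order.
  have hsupp : ∀ p q : n × n, p ≠ q → p ≠ q.swap → X p q = 0 := by
    intro p q h1 h2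
    by_contra h0
    have key : ∀ m, (if p.1 = m then Complex.I else 1) * (if p.2 = m then Complex.I else 1) =
        (if q.1 = m then Complex.I else 1) * (if q.2 = m then Complex.I else 1) := by
      intro m
      have := hdiag (fun i => if i = m then Complex.I else 1)
        (by intro i; split_ifs <;> simp) p q
      rw [mul_comm (X p q)] at this
      exact mul_right_cancel₀ h0 this
    have hI1 : Complex.I ≠ 1 := by
      intro h; have := congrArg Complex.re h; simp at this
    have hI2 : (-1 : ℂ) ≠ 1 := by norm_num
    have hI3 : (-1 : ℂ) ≠ Complex.I := by
      intro h; have := congrArg Complex.re h; simp at this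
    obtain ⟨p1, p2⟩ := p
    obtain ⟨q1, q2⟩ := q
    have k1 := key p1
    have k2 := key p2
    simp only [Prod.swap_prod_mk, ne_eq, Prod.mk.injEq, not_and] at h1 h2 k1 k2
    by_cases e1 : p1 = p2
    · subst e1
      by_cases f1 : q1 = p1 <;> by_cases f2 : q2 = p1 <;>
        simp_all [Complex.I_mul_I]
    · have e2 : p2 ≠ p1 := Ne.symm e1
      simp only [if_true, if_neg e1, if_neg e2] at k1 k2
      clear key hperm hdiag hX h0
      have hI4 : (1 : ℂ) ≠ Complex.I := hI1.symm
      split_ifs at k1 k2 <;> simp only [mul_one, one_mul, Complex.I_mul_I] at k1 k2 <;>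
        first
        | exact absurd k1 hI1
        | exact absurd k2 hI1
        | exact absurd k1.symm hI3
        | exact absurd k2.symm hI3
        | grind
  obtain ⟨x, y, hxy⟩ := exists_pair_ne n
  -- Permutations act transitively on ordered pairs of distinct indices, so the entries (ij, ij)
  -- with i ≠ j share one value, and so do the entries (ij, ji).
  have htrans : ∀ i j : n, i ≠ j → ∃ σ : Equiv.Perm n, σ x = i ∧ σ y = j := by
    intro i j hij
    refine ⟨Equiv.swap (Equiv.swap x i y) j * Equiv.swap x i, ?_, ?_⟩
    · rw [Equiv.Perm.mul_apply, Equiv.swap_apply_left, Equiv.swap_apply_of_ne_of_ne _ hij]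
      intro h
      exact hxy ((Equiv.swap x i).injective (by rw [Equiv.swap_apply_left, ← h]))
    · rw [Equiv.Perm.mul_apply, Equiv.swap_apply_left]
  have hb : ∀ i j, i ≠ j → X (i, j) (i, j) = X (x, y) (x, y) := by
    intro i j hij
    obtain ⟨σ, rfl, rfl⟩ := htrans i j hij
    exact hperm σ (x, y) (x, y)
  have hc : ∀ i j, i ≠ j → X (i, j) (j, i) = X (x, y) (y, x) := by
    intro i j hij
    obtain ⟨σ, rfl, rfl⟩ := htrans i j hij
    exact hperm σ (x, y) (y, x)
  -- Diagonal and permutation matrices leave the entry at (ii, ii) free. A unitary with u_ii u_ij ≠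
  -- 0 ties it to the others through the entry (ii, ij) of the commutation relation.
  have ha : ∀ i, X (i, i) (i, i) = X (x, y) (x, y) + X (x, y) (y, x) := by
    intro i
    obtain ⟨j, hji⟩ := exists_ne i
    obtain ⟨u, hu, h1, h2⟩ := exists_unitary_mixing hji.symm
    have h := congrFun (congrFun (hX u hu) (i, i)) (i, j)
    rw [Matrix.mul_apply, Matrix.mul_apply, Finset.sum_eq_add (i, j) (j, i) (by simp [hji]),
      Finset.sum_eq_single (i, i)] at h
    · rw [hb i j hji.symm, hc j i hji] at h
      simp only [Matrix.kroneckerMap_apply] at h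
      have h3 := mul_ne_zero h1 h2
      apply mul_left_cancel₀ h3
      linear_combination -h
    · intro r _ hr
      rw [hsupp _ _ hr.symm (by rintro h; apply hr; rw [← Prod.swap_swap r, ← h]; rfl), zero_mul]
    · simp
    · rintro r _ ⟨hr1, hr2⟩
      rw [hsupp _ _ hr1 hr2, mul_zero]
    · simp
    · simp
  refine ⟨X (x, y) (x, y), X (x, y) (y, x), ?_⟩
  ext ⟨i, j⟩ q
  rw [Matrix.add_apply, Matrix.smul_apply, Matrix.smul_apply, flipMatrix_apply, Matrix.one_apply]
  by_cases h1 : (i, j) = q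
  · subst h1
    by_cases hij : i = j
    · subst hij
      simp [ha]
    · simp [hij, hb]
  · by_cases h2 : (i, j) = q.swap
    · obtain ⟨k, l⟩ := q
      simp only [Prod.swap_prod_mk, Prod.mk.injEq] at h2
      obtain ⟨rfl, rfl⟩ := h2
      have hij : i ≠ j := by rintro rfl; exact h1 rfl
      simp [hij, hc]
    · rw [hsupp _ _ h1 h2]
      simp [h1, h2]

end Commutant

/-! ### Symmetric and antisymmetric projections. -/

section SymmetryProjections

/-- The sign `±1` attached to a symmetry type. -/
def symSign (s : Bool) : ℂ := if s then 1 else -1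

theorem symSign_mul_self (s : Bool) : symSign s * symSign s = 1 := by
  cases s <;> simp [symSign]

/-- The projections onto the symmetric (`true`) and antisymmetric (`false`) subspaces. -/
noncomputable def symProj (n : Type*) [DecidableEq n] (s : Bool) : Matrix (n × n) (n × n) ℂ :=
  (1 / 2 : ℂ) • (1 + symSign s • flipMatrix n)

/-- The dimensions of the symmetric and antisymmetric subspaces. -/
noncomputable def symDim (n : Type*) [Fintype n] (s : Bool) : ℂ :=
  Fintype.card n * (Fintype.card n + symSign s) / 2

/-- In dimension one the antisymmetric space is zero, which is why nontriviality is assumed here. -/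
theorem symDim_ne_zero {n : Type*} [Fintype n] [Nontrivial n] (s : Bool) : symDim n s ≠ 0 := by
  have h : 1 < Fintype.card n := Fintype.one_lt_card
  have h0 : (Fintype.card n : ℂ) ≠ 0 := by exact_mod_cast (by omega : Fintype.card n ≠ 0)
  have h1 : (Fintype.card n : ℂ) + symSign s ≠ 0 := by
    cases s
    · have : (Fintype.card n : ℂ) ≠ 1 := by exact_mod_cast h.ne'
      simpa [symSign, ← sub_eq_add_neg, sub_ne_zero] using this
    · have : ((Fintype.card n + 1 : ℕ) : ℂ) ≠ 0 := by exact_mod_cast (Nat.succ_ne_zero (Fintype.card n))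
      simpa [symSign] using this
  rw [symDim]
  exact div_ne_zero (mul_ne_zero h0 h1) two_ne_zero

variable {n : Type*} [DecidableEq n]

theorem symProj_conjTranspose (s : Bool) : (symProj n s)ᴴ = symProj n s := by
  cases s <;> simp [symProj, symSign, flipMatrix_conjTranspose]

theorem symProj_add : symProj n true + symProj n false = 1 := by
  rw [symProj, symProj, ← smul_add]
  ext p q
  simp [symSign]
  ring

theorem symProj_sub : symProj n true - symProj n false = flipMatrix n := by
  rw [symProj, symProj, ← smul_sub]
  ext p q
  simp [symSign]
  ring

variable [Fintype n]

theorem flipMatrix_mul_symProj (s : Bool) :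
    flipMatrix n * symProj n s = symSign s • symProj n s := by
  rw [symProj, Matrix.mul_smul, Matrix.mul_add, Matrix.mul_smul, flipMatrix_mul_self,
    Matrix.mul_one, smul_comm (symSign s), smul_add (symSign s), smul_smul (symSign s),
    symSign_mul_self, one_smul, add_comm]

theorem symProj_mul_symProj (s t : Bool) :
    symProj n s * symProj n t = if s = t then symProj n s else 0 := by
  have h : symProj n s * symProj n t = ((1 + symSign s * symSign t) / 2) • symProj n t := by
    conv_lhs => rw [symProj]
    rw [Matrix.smul_mul, Matrix.add_mul, Matrix.one_mul, Matrix.smul_mul, flipMatrix_mul_symProj,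
      smul_smul]
    module
  rw [h]
  cases s <;> cases t <;> simp [symSign]

theorem symProj_trace (s : Bool) : (symProj n s).trace = symDim n s := by
  rw [symProj, Matrix.trace_smul, Matrix.trace_add, Matrix.trace_smul, flipMatrix_trace,
    Matrix.trace_one, symDim, Fintype.card_prod]
  push_cast
  simp only [smul_eq_mul]
  ring

theorem kronecker_self_commute_symProj (A : Matrix n n ℂ) (s : Bool) :
    (A ⊗ₖ A) * symProj n s = symProj n s * (A ⊗ₖ A) := by
  rw [symProj, Matrix.mul_smul, Matrix.smul_mul, Matrix.mul_add, Matrix.add_mul, Matrix.mul_smul,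
    Matrix.smul_mul, kronecker_self_commute_flipMatrix, Matrix.one_mul, Matrix.mul_one]

/-- The two orthogonal projections span the same space as 1 and the flip, so the coefficients are
read off by taking traces against them. -/
theorem eq_sum_symProj_of_commute [Nontrivial n] {X : Matrix (n × n) (n × n) ℂ}
    (hX : ∀ u ∈ Matrix.unitaryGroup n ℂ, (u ⊗ₖ u) * X = X * (u ⊗ₖ u)) :
    X = ∑ s, ((symProj n s * X).trace / symDim n s) • symProj n s := by
  obtain ⟨b, c, h⟩ := commutant_kronecker_self hX
  have h' : X = (b + c) • symProj n true + (b - c) • symProj n false := by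
    rw [h, ← symProj_add, ← symProj_sub]
    simp only [add_smul, sub_smul, smul_add, smul_sub]
    abel
  have h1 := symDim_ne_zero (n := n) true
  have h2 := symDim_ne_zero (n := n) false
  have e1 : (symProj n true * X).trace = (b + c) * symDim n true := by
    rw [h', Matrix.mul_add, Matrix.mul_smul, Matrix.mul_smul, symProj_mul_symProj,
      symProj_mul_symProj]
    simp [symProj_trace]
  have e2 : (symProj n false * X).trace = (b - c) * symDim n false := by
    rw [h', Matrix.mul_add, Matrix.mul_smul, Matrix.mul_smul, symProj_mul_symProj,
      symProj_mul_symProj]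
    simp [symProj_trace]
  rw [Fintype.sum_bool, e1, e2, mul_div_assoc, mul_div_assoc, div_self h1, div_self h2, mul_one,
    mul_one]
  exact h'

end SymmetryProjections

/-! ### Second moments of conjugation-invariant distributions; the Haar measure. -/

section Moments

variable {n : Type*} [Fintype n] [DecidableEq n]

/-- The mean of a random operator on `ℂ^n ⊗ ℂ^n` whose distribution is invariant under
conjugation by every `u ⊗ u`. -/
theorem integral_apply_of_conj_invariant [Nontrivial n] {Ω : Type*} [MeasurableSpace Ω]
    (μ : Measure Ω) [IsProbabilityMeasure μ] (F : Ω → Matrix (n × n) (n × n) ℂ)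
    (hF : ∀ p q, Integrable (fun ω => F ω p q) μ)
    (hinv : ∀ u ∈ Matrix.unitaryGroup n ℂ, ∀ p q,
      ∫ ω, ((u ⊗ₖ u) * F ω * (u ⊗ₖ u)ᴴ) p q ∂μ = ∫ ω, F ω p q ∂μ)
    (t : Bool → ℂ) (ht : ∀ s ω, (symProj n s * F ω).trace = t s) (p q : n × n) :
    ∫ ω, F ω p q ∂μ = ∑ s, t s / symDim n s * symProj n s p q := by
  set X : Matrix (n × n) (n × n) ℂ := Matrix.of fun p q => ∫ ω, F ω p q ∂μ with hX
  have hmul : ∀ (A B : Matrix (n × n) (n × n) ℂ) p q,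
      (A * X * B) p q = ∫ ω, (A * F ω * B) p q ∂μ := by
    intro A B p q
    simp only [Matrix.mul_apply, hX, Matrix.of_apply]
    rw [integral_finsetSum]
    · refine Finset.sum_congr rfl fun r _ => ?_
      rw [integral_mul_const, integral_finsetSum]
      · simp only [integral_const_mul]
      · exact fun x _ => (hF x r).const_mul _
    · exact fun x _ => (integrable_finsetSum _ fun y _ => (hF y x).const_mul _).mul_const _
  -- Invariance places the mean X in the commutant; the fixed traces t then determine it.
  have hcomm : ∀ u ∈ Matrix.unitaryGroup n ℂ, (u ⊗ₖ u) * X = X * (u ⊗ₖ u) := by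
    intro u hu
    have h1 : (u ⊗ₖ u) * X * (u ⊗ₖ u)ᴴ = X := by
      ext p q
      rw [hmul, hinv u hu]
      rfl
    have h2 : (u ⊗ₖ u)ᴴ * (u ⊗ₖ u) = 1 :=
      Unitary.star_mul_self_of_mem (Matrix.kronecker_mem_unitary hu hu)
    conv_rhs => rw [← h1]
    rw [Matrix.mul_assoc, h2, Matrix.mul_one]
  have htr : ∀ s, (symProj n s * X).trace = t s := by
    intro s
    have h1 : ∀ p, (symProj n s * X) p p = ∫ ω, (symProj n s * F ω) p p ∂μ := by
      intro p
      simpa using hmul (symProj n s) 1 p p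
    rw [Matrix.trace]
    simp only [Matrix.diag_apply, h1]
    rw [← integral_finsetSum]
    · have : ∀ ω, ∑ p, (symProj n s * F ω) p p = t s := ht s
      simp [this]
    · intro p _
      simp only [Matrix.mul_apply]
      exact integrable_finsetSum _ fun y _ => (hF y p).const_mul _
  have := eq_sum_symProj_of_commute hcomm
  calc ∫ ω, F ω p q ∂μ = X p q := rfl
    _ = _ := by
      rw [this, Matrix.sum_apply]
      exact Finset.sum_congr rfl fun s _ => by rw [htr]; rfl

instance : IsProbabilityMeasure (haarUnitary n) :=
  ⟨Measure.haarMeasure_self (K₀ := (⊤ : TopologicalSpace.PositiveCompacts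
    (Matrix.unitaryGroup n ℂ)))⟩

instance : (haarUnitary n).IsMulLeftInvariant :=
  inferInstanceAs (Measure.haarMeasure _).IsMulLeftInvariant

theorem integrable_haarUnitary {f : Matrix.unitaryGroup n ℂ → ℂ} (hf : Continuous f) :
    Integrable f (haarUnitary n) :=
  hf.integrable_of_hasCompactSupport (HasCompactSupport.of_compactSpace f)

theorem continuous_unitaryGroup_apply (i j : n) :
    Continuous fun u : Matrix.unitaryGroup n ℂ => (u : Matrix n n ℂ) i j :=
  continuous_subtype_val.matrix_elem i j

/-- Second order Weingarten formula for the Haar measure of the unitary group. -/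
theorem integral_kronecker_self_mul_star [Nontrivial n] (i j k l : n × n) :
    ∫ u, ((u : Matrix n n ℂ) ⊗ₖ (u : Matrix n n ℂ)) i j *
        star (((u : Matrix n n ℂ) ⊗ₖ (u : Matrix n n ℂ)) k l) ∂(haarUnitary n) =
      ∑ s, symProj n s l j / symDim n s * symProj n s i k := by
  -- Conjugating the matrix unit at (j, l) by u ⊗ u gives a random operator whose (i, k) entry is
  -- the integrand.
  set F : Matrix.unitaryGroup n ℂ → Matrix (n × n) (n × n) ℂ := fun u =>
    ((u : Matrix n n ℂ) ⊗ₖ (u : Matrix n n ℂ)) * Matrix.single j l 1 *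
      ((u : Matrix n n ℂ) ⊗ₖ (u : Matrix n n ℂ))ᴴ with hF
  have hFe : ∀ u p q, F u p q = ((u : Matrix n n ℂ) ⊗ₖ (u : Matrix n n ℂ)) p j *
        star (((u : Matrix n n ℂ) ⊗ₖ (u : Matrix n n ℂ)) q l) := by
    intro u p q
    rw [hF]
    dsimp only
    rw [Matrix.mul_apply, Finset.sum_eq_single l]
    · simp
    · intro b _ hb
      rw [Matrix.mul_single_apply_of_ne _ _ _ _ _ hb, zero_mul]
    · simp
  have hFc : ∀ p q, Continuous fun u => F u p q := by
    intro p q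
    simp only [hFe, Matrix.kroneckerMap_apply]
    have h := continuous_unitaryGroup_apply (n := n)
    exact ((h _ _).mul (h _ _)).mul ((h _ _).mul (h _ _)).star
  simp only [← hFe]
  refine integral_apply_of_conj_invariant (haarUnitary n) F
    (fun p q => integrable_haarUnitary (hFc p q)) ?_ (fun s => symProj n s l j) ?_ i k
  · intro u hu p q
    rw [← integral_mul_left_eq_self (μ := haarUnitary n) (fun v => F v p q) ⟨u, hu⟩]
    congr 1
    ext v
    simp only [hF, Submonoid.coe_mul, Matrix.mul_kronecker_mul, Matrix.conjTranspose_mul,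
      Matrix.mul_assoc]
  · intro s u
    have h2 : ((u : Matrix n n ℂ) ⊗ₖ (u : Matrix n n ℂ))ᴴ * ((u : Matrix n n ℂ) ⊗ₖ (u : Matrix n n ℂ)) = 1 :=
      Unitary.star_mul_self_of_mem (Matrix.kronecker_mem_unitary u.2 u.2)
    rw [hF]
    dsimp only
    rw [← Matrix.mul_assoc, Matrix.trace_mul_comm, ← Matrix.mul_assoc, ← Matrix.mul_assoc,
      Matrix.mul_assoc _ (symProj n s), ← kronecker_self_commute_symProj, ← Matrix.mul_assoc, h2,
      Matrix.one_mul]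
    simp [Matrix.trace_mul_single]

/-! ### Moments of the uniform distribution on the unit sphere. -/

/-- The normalized surface measure of the unit sphere of `ℂ^N`. -/
noncomputable def sphereMeasure (N : ℕ) :
    Measure (Metric.sphere (0 : EuclideanSpace ℂ (Fin N)) 1) :=
  ((volume : Measure (EuclideanSpace ℂ (Fin N))).toSphere Set.univ)⁻¹ •
    (volume : Measure (EuclideanSpace ℂ (Fin N))).toSphere

theorem isProbabilityMeasure_sphereMeasure {N : ℕ} (hN : N ≠ 0) :
    IsProbabilityMeasure (sphereMeasure N) := by
  have : Nonempty (Fin N) := ⟨⟨0, Nat.pos_of_ne_zero hN⟩⟩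
  refine ⟨?_⟩
  rw [sphereMeasure, Measure.smul_apply, smul_eq_mul, ENNReal.inv_mul_cancel]
  · simpa only [ne_eq, Measure.measure_univ_eq_zero] using
      Measure.toSphere_ne_zero (volume : Measure (EuclideanSpace ℂ (Fin N)))
  · exact measure_ne_top _ _

/-- The action of a linear isometry on the unit sphere. -/
def sphereIsometry {E : Type*} [NormedAddCommGroup E] [NormedSpace ℝ E] (f : E ≃ₗᵢ[ℝ] E) :
    Metric.sphere (0 : E) 1 → Metric.sphere (0 : E) 1 :=
  fun x => ⟨f x, by simp⟩

-- The surface measure of a set is, up to the dimension factor, the volume of the cone over it, and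
-- a linear isometry maps cones to cones and preserves volume.
open scoped Pointwise in
theorem measurePreserving_sphereIsometry {E : Type*} [NormedAddCommGroup E]
    [InnerProductSpace ℝ E] [FiniteDimensional ℝ E] [MeasurableSpace E] [BorelSpace E]
    (f : E ≃ₗᵢ[ℝ] E) :
    MeasurePreserving (sphereIsometry f) (volume : Measure E).toSphere
      (volume : Measure E).toSphere := by
  have hm : Measurable (sphereIsometry f) :=
    Continuous.measurable ((f.continuous.comp continuous_subtype_val).subtype_mk _)
  refine ⟨hm, ?_⟩
  ext s hs
  rw [Measure.map_apply hm hs, Measure.toSphere_apply' _ (hm hs), Measure.toSphere_apply' _ hs]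
  congr 1
  conv_rhs => rw [← f.measurePreserving.measure_preimage_equiv (f := f.toHomeomorph.toMeasurableEquiv)]
  congr 1
  ext x
  simp only [Set.mem_smul, Set.mem_image, Set.mem_preimage]
  constructor
  · rintro ⟨r, hr, _, ⟨y, hy, rfl⟩, rfl⟩
    exact ⟨r, hr, _, ⟨_, hy, rfl⟩, (f.map_smul r (y : E)).symm⟩
  · rintro ⟨r, hr, _, ⟨y, hy, rfl⟩, hxy⟩
    have hxy' : r • (y : E) = f x := hxy
    refine ⟨r, hr, f.symm y, ⟨⟨f.symm y, by simp⟩, ?_, rfl⟩, ?_⟩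
    · simpa [sphereIsometry] using hy
    · rw [← f.symm.map_smul, hxy', f.symm_apply_apply]

/-- A unitary matrix as a real linear isometry of `ℂ^N`. -/
noncomputable def unitaryIsometry {N : ℕ} (u : Matrix.unitaryGroup (Fin N) ℂ) :
    EuclideanSpace ℂ (Fin N) ≃ₗᵢ[ℝ] EuclideanSpace ℂ (Fin N) :=
  let e := Unitary.linearIsometryEquiv
    (⟨Matrix.toEuclideanCLM (𝕜 := ℂ) (u : Matrix (Fin N) (Fin N) ℂ),
      Unitary.map_mem _ u.2⟩ : unitary (EuclideanSpace ℂ (Fin N) →L[ℂ] EuclideanSpace ℂ (Fin N)))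
  { e.toLinearEquiv.restrictScalars ℝ with norm_map' := e.norm_map }

theorem integrable_sphereMeasure {N : ℕ}
    {f : Metric.sphere (0 : EuclideanSpace ℂ (Fin N)) 1 → ℂ} (hf : Continuous f) :
    Integrable f (sphereMeasure N) := by
  rcases Nat.eq_zero_or_pos N with rfl | hN
  · have : Measure.toSphere (volume : Measure (EuclideanSpace ℂ (Fin 0))) = 0 := by
      rw [Measure.toSphere_eq_zero_iff]
      infer_instance
    simp [sphereMeasure, this]
  · have := isProbabilityMeasure_sphereMeasure hN.ne'
    exact hf.integrable_of_hasCompactSupport (HasCompactSupport.of_compactSpace f)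

/-- The tensor square of a vector. -/
def tensorSq {m : Type*} (a : m → ℂ) : m × m → ℂ := fun p => a p.1 * a p.2

theorem kronecker_self_mulVec_tensorSq {m : Type*} [Fintype m] (A : Matrix m m ℂ) (a : m → ℂ) :
    (A ⊗ₖ A) *ᵥ tensorSq a = tensorSq (A *ᵥ a) := by
  ext p
  simp only [Matrix.mulVec, dotProduct, tensorSq, Matrix.kroneckerMap_apply]
  rw [Finset.sum_mul_sum, ← Finset.sum_product', Finset.univ_product_univ]
  exact Finset.sum_congr rfl fun q _ => by ring

/-- Fourth moments of the uniform distribution on the unit sphere of `ℂ^N`. -/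
theorem integral_tensorSq_mul_star {N : ℕ} (hN : 2 ≤ N) (p q : Fin N × Fin N) :
    ∫ a, tensorSq (a : EuclideanSpace ℂ (Fin N)) p * star (tensorSq (a : EuclideanSpace ℂ (Fin N)) q)
        ∂(sphereMeasure N) =
      (symDim (Fin N) true)⁻¹ * symProj (Fin N) true p q := by
  have := isProbabilityMeasure_sphereMeasure (N := N) (by omega)
  have : Nontrivial (Fin N) := Fin.nontrivial_iff_two_le.2 hN
  set F : Metric.sphere (0 : EuclideanSpace ℂ (Fin N)) 1 →
      Matrix (Fin N × Fin N) (Fin N × Fin N) ℂ := fun a =>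
    vecMulVec (tensorSq (a : EuclideanSpace ℂ (Fin N)))
      (star (tensorSq (a : EuclideanSpace ℂ (Fin N)))) with hF
  have hFc : ∀ p q, Continuous fun a => F a p q := by
    intro p q
    have h : ∀ i, Continuous fun a : Metric.sphere (0 : EuclideanSpace ℂ (Fin N)) 1 =>
        (a : EuclideanSpace ℂ (Fin N)) i := fun i => by fun_prop
    exact ((h _).mul (h _)).mul ((h _).mul (h _)).star
  have hmain := integral_apply_of_conj_invariant (sphereMeasure N) F
    (fun p q => integrable_sphereMeasure (hFc p q)) ?_ (fun s => if s then 1 else 0) ?_ p q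
  · simpa [hF, vecMulVec_apply] using hmain
  · intro u hu p q
    have hmp : MeasurePreserving (sphereIsometry (unitaryIsometry ⟨u, hu⟩)) (sphereMeasure N)
        (sphereMeasure N) :=
      (measurePreserving_sphereIsometry (unitaryIsometry ⟨u, hu⟩)).smul_measure _
    rw [← hmp.map_eq, integral_map hmp.measurable.aemeasurable
      (hFc p q).aestronglyMeasurable, hmp.map_eq]
    congr 1
    ext a
    have h1 : tensorSq (sphereIsometry (unitaryIsometry ⟨u, hu⟩) a : EuclideanSpace ℂ (Fin N)) =
        (u ⊗ₖ u) *ᵥ tensorSq (a : EuclideanSpace ℂ (Fin N)) := by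
      rw [kronecker_self_mulVec_tensorSq]
      rfl
    simp only [hF]
    rw [h1, Matrix.mul_vecMulVec, Matrix.vecMulVec_mul, Matrix.star_mulVec]
  · intro s a
    -- The vector a ⊗ a is symmetric of norm one, so the projection onto it has trace 1 against P₊
    -- and 0 against P₋.
    have hflip : flipMatrix (Fin N) *ᵥ tensorSq (a : EuclideanSpace ℂ (Fin N)) =
        tensorSq (a : EuclideanSpace ℂ (Fin N)) := by
      ext p
      rw [Matrix.mulVec, dotProduct, Finset.sum_eq_single p.swap]
      · simp [flipMatrix_apply, tensorSq, mul_comm]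
      · intro b _ hb
        rw [flipMatrix_apply, if_neg, zero_mul]
        rintro rfl
        simp at hb
      · simp
    have hnorm : tensorSq (a : EuclideanSpace ℂ (Fin N)) ⬝ᵥ
        star (tensorSq (a : EuclideanSpace ℂ (Fin N))) = 1 := by
      have h1 : ∑ i, (a : EuclideanSpace ℂ (Fin N)) i * star ((a : EuclideanSpace ℂ (Fin N)) i) = 1 := by
        have h2 : ‖(a : EuclideanSpace ℂ (Fin N))‖ ^ 2 = 1 := by simp
        rw [EuclideanSpace.norm_sq_eq] at h2
        simp only [RCLike.star_def, Complex.mul_conj']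
        exact_mod_cast h2
      calc _ = (∑ i, (a : EuclideanSpace ℂ (Fin N)) i * star ((a : EuclideanSpace ℂ (Fin N)) i)) *
            ∑ i, (a : EuclideanSpace ℂ (Fin N)) i * star ((a : EuclideanSpace ℂ (Fin N)) i) := by
            rw [Finset.sum_mul_sum, ← Finset.sum_product', Finset.univ_product_univ, dotProduct]
            exact Finset.sum_congr rfl fun q _ => by simp [tensorSq]; ring
        _ = 1 := by rw [h1, one_mul]
    rw [hF]
    dsimp only
    rw [Matrix.mul_vecMulVec, Matrix.trace_vecMulVec, symProj, Matrix.smul_mulVec,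
      Matrix.add_mulVec, Matrix.smul_mulVec, Matrix.one_mulVec, hflip]
    cases s <;> simp [symSign, hnorm]
    norm_num

end Moments

/-! ### Averages over u ⊗ u and over (u ⊗ u) ⊗ (v ⊗ v). -/

section Twirl

/-- This expansion and the one in `trace_mul_mul_trace_mul_eq_sum` carry the same factors of X and Y
at each index, so averaging only has to turn the coefficients of one into those of the other. -/
theorem trace_conj_mul_eq_sum {m : Type*} [Fintype m] (L X Y : Matrix m m ℂ) :
    (L * X * Lᴴ * Y).trace = ∑ x : (m × m) × (m × m),
      L x.1.1 x.1.2 * star (L x.2.1 x.2.2) * (X x.1.2 x.2.2 * Y x.2.1 x.1.1) := by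
  simp only [Matrix.trace, Matrix.diag_apply, Matrix.mul_apply, Finset.sum_mul,
    Matrix.conjTranspose_apply, Fintype.sum_prod_type]
  refine Finset.sum_congr rfl fun i _ => ?_
  rw [Finset.sum_comm_cycle]
  refine Finset.sum_congr rfl fun j _ => Finset.sum_congr rfl fun k _ =>
    Finset.sum_congr rfl fun l _ => ?_
  ring

theorem trace_mul_mul_trace_mul_eq_sum {m : Type*} [Fintype m] (Z X Y : Matrix m m ℂ) :
    (Z * X).trace * (Z * Y).trace = ∑ x : (m × m) × (m × m),
      (Z x.2.2 x.1.2 * Z x.1.1 x.2.1) * (X x.1.2 x.2.2 * Y x.2.1 x.1.1) := by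
  have h : ∀ A B : Matrix m m ℂ, (A * B).trace = ∑ x : m × m, A x.2 x.1 * B x.1 x.2 := by
    intro A B
    rw [Matrix.trace_mul_comm]
    simp only [Matrix.trace, Matrix.diag_apply, Matrix.mul_apply, Fintype.sum_prod_type]
    exact Finset.sum_congr rfl fun i _ => Finset.sum_congr rfl fun j _ => mul_comm _ _
  rw [h, h, Finset.sum_mul_sum, ← Finset.sum_product', Finset.univ_product_univ]
  let e : (m × m) × (m × m) ≃ (m × m) × (m × m) :=
    { toFun := fun x => ((x.2.2, x.1.1), (x.2.1, x.1.2))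
      invFun := fun y => ((y.1.2, y.2.2), (y.2.1, y.1.1))
      left_inv := fun _ => rfl
      right_inv := fun _ => rfl }
  refine Fintype.sum_equiv e _ _ fun x => ?_
  simp only [e, Equiv.coe_fn_mk]
  ring

variable {n : Type*} [Fintype n] [DecidableEq n]

/-- The average of `tr (w X wᴴ Y)` over `w = u ⊗ u`. -/
theorem integral_trace_twirl [Nontrivial n] (X Y : Matrix (n × n) (n × n) ℂ) :
    ∫ u, (((u : Matrix n n ℂ) ⊗ₖ (u : Matrix n n ℂ)) * X *
        ((u : Matrix n n ℂ) ⊗ₖ (u : Matrix n n ℂ))ᴴ * Y).trace ∂(haarUnitary n) =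
      ∑ s, (symProj n s * X).trace * (symProj n s * Y).trace / symDim n s := by
  have h := continuous_unitaryGroup_apply (n := n)
  simp only [trace_conj_mul_eq_sum]
  rw [integral_finsetSum]
  · simp only [integral_mul_const, integral_kronecker_self_mul_star,
      trace_mul_mul_trace_mul_eq_sum, Finset.sum_div]
    rw [Finset.sum_comm]
    refine Finset.sum_congr rfl fun x _ => ?_
    rw [Finset.sum_mul]
    refine Finset.sum_congr rfl fun s _ => ?_
    ring
  · intro x _
    refine integrable_haarUnitary ?_
    exact (((h _ _).mul (h _ _)).mul ((h _ _).mul (h _ _)).star).mul continuous_const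

/-- The average of `tr (L X Lᴴ Y)` over `L = (u ⊗ u) ⊗ (v ⊗ v)` with independent `u`, `v`. -/
theorem integral_trace_local_twirl [Nontrivial n]
    (X Y : Matrix ((n × n) × (n × n)) ((n × n) × (n × n)) ℂ) :
    ∫ w : Matrix.unitaryGroup n ℂ × Matrix.unitaryGroup n ℂ,
      ((((w.1 : Matrix n n ℂ) ⊗ₖ (w.1 : Matrix n n ℂ)) ⊗ₖ
          ((w.2 : Matrix n n ℂ) ⊗ₖ (w.2 : Matrix n n ℂ))) * X *
        (((w.1 : Matrix n n ℂ) ⊗ₖ (w.1 : Matrix n n ℂ)) ⊗ₖ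
          ((w.2 : Matrix n n ℂ) ⊗ₖ (w.2 : Matrix n n ℂ)))ᴴ * Y).trace
        ∂((haarUnitary n).prod (haarUnitary n)) =
      ∑ s, ∑ t, ((symProj n s ⊗ₖ symProj n t) * X).trace *
        ((symProj n s ⊗ₖ symProj n t) * Y).trace / (symDim n s * symDim n t) := by
  have h := continuous_unitaryGroup_apply (n := n)
  have hc : ∀ i j k l : n × n, Continuous fun u : Matrix.unitaryGroup n ℂ =>
      ((u : Matrix n n ℂ) ⊗ₖ (u : Matrix n n ℂ)) i j *
        star (((u : Matrix n n ℂ) ⊗ₖ (u : Matrix n n ℂ)) k l) := fun i j k l =>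
    ((h _ _).mul (h _ _)).mul ((h _ _).mul (h _ _)).star
  simp only [trace_conj_mul_eq_sum]
  have hfac : ∀ (x : (((n × n) × (n × n)) × ((n × n) × (n × n))) ×
      (((n × n) × (n × n)) × ((n × n) × (n × n))))
      (w : Matrix.unitaryGroup n ℂ × Matrix.unitaryGroup n ℂ),
      (((w.1 : Matrix n n ℂ) ⊗ₖ (w.1 : Matrix n n ℂ)) ⊗ₖ
          ((w.2 : Matrix n n ℂ) ⊗ₖ (w.2 : Matrix n n ℂ))) x.1.1 x.1.2 *
        star ((((w.1 : Matrix n n ℂ) ⊗ₖ (w.1 : Matrix n n ℂ)) ⊗ₖ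
          ((w.2 : Matrix n n ℂ) ⊗ₖ (w.2 : Matrix n n ℂ))) x.2.1 x.2.2) =
      (((w.1 : Matrix n n ℂ) ⊗ₖ (w.1 : Matrix n n ℂ)) x.1.1.1 x.1.2.1 *
        star (((w.1 : Matrix n n ℂ) ⊗ₖ (w.1 : Matrix n n ℂ)) x.2.1.1 x.2.2.1)) *
      (((w.2 : Matrix n n ℂ) ⊗ₖ (w.2 : Matrix n n ℂ)) x.1.1.2 x.1.2.2 *
        star (((w.2 : Matrix n n ℂ) ⊗ₖ (w.2 : Matrix n n ℂ)) x.2.1.2 x.2.2.2)) := by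
    intro x w
    rw [Matrix.kroneckerMap_apply (fun a b => a * b) (_ ⊗ₖ _),
      Matrix.kroneckerMap_apply (fun a b => a * b) (_ ⊗ₖ _), star_mul']
    ring
  simp only [hfac]
  rw [integral_finsetSum]
  · simp only [integral_mul_const]
    have hprod : ∀ x : (((n × n) × (n × n)) × ((n × n) × (n × n))) ×
        (((n × n) × (n × n)) × ((n × n) × (n × n))),
        ∫ w : Matrix.unitaryGroup n ℂ × Matrix.unitaryGroup n ℂ,
          (((w.1 : Matrix n n ℂ) ⊗ₖ (w.1 : Matrix n n ℂ)) x.1.1.1 x.1.2.1 *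
            star (((w.1 : Matrix n n ℂ) ⊗ₖ (w.1 : Matrix n n ℂ)) x.2.1.1 x.2.2.1)) *
          (((w.2 : Matrix n n ℂ) ⊗ₖ (w.2 : Matrix n n ℂ)) x.1.1.2 x.1.2.2 *
            star (((w.2 : Matrix n n ℂ) ⊗ₖ (w.2 : Matrix n n ℂ)) x.2.1.2 x.2.2.2))
          ∂((haarUnitary n).prod (haarUnitary n)) =
        ∑ s, ∑ t, ((symProj n s ⊗ₖ symProj n t) x.2.2 x.1.2 *
          (symProj n s ⊗ₖ symProj n t) x.1.1 x.2.1) / (symDim n s * symDim n t) := by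
      intro x
      rw [integral_prod_mul (fun u : Matrix.unitaryGroup n ℂ =>
        ((u : Matrix n n ℂ) ⊗ₖ (u : Matrix n n ℂ)) x.1.1.1 x.1.2.1 *
            star (((u : Matrix n n ℂ) ⊗ₖ (u : Matrix n n ℂ)) x.2.1.1 x.2.2.1))
        (fun u : Matrix.unitaryGroup n ℂ =>
        ((u : Matrix n n ℂ) ⊗ₖ (u : Matrix n n ℂ)) x.1.1.2 x.1.2.2 *
            star (((u : Matrix n n ℂ) ⊗ₖ (u : Matrix n n ℂ)) x.2.1.2 x.2.2.2)),
        integral_kronecker_self_mul_star, integral_kronecker_self_mul_star, Finset.sum_mul_sum]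
      refine Finset.sum_congr rfl fun s _ => Finset.sum_congr rfl fun t _ => ?_
      simp only [Matrix.kroneckerMap_apply]
      ring
    simp only [hprod, trace_mul_mul_trace_mul_eq_sum, Finset.sum_div, Finset.sum_mul]
    rw [Finset.sum_comm]
    refine Finset.sum_congr rfl fun s _ => ?_
    rw [Finset.sum_comm]
    refine Finset.sum_congr rfl fun t _ => Finset.sum_congr rfl fun x _ => ?_
    ring
  · intro x _
    exact ((integrable_haarUnitary (hc _ _ _ _)).mul_prod
      (integrable_haarUnitary (hc _ _ _ _))).mul_const _

end Twirl

/-! ### Two copies of a bipartite operator. -/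

section TwoCopy

variable {n : Type*}

/-- Two copies of a bipartite operator, with the tensor factors ordered as `A A B B`. -/
def twoCopy (V : Matrix (n × n) (n × n) ℂ) :
    Matrix ((n × n) × (n × n)) ((n × n) × (n × n)) ℂ :=
  (V ⊗ₖ V).submatrix (Equiv.prodProdProdComm n n n n) (Equiv.prodProdProdComm n n n n)

theorem twoCopy_apply (V : Matrix (n × n) (n × n) ℂ) (p q : (n × n) × (n × n)) :
    twoCopy V p q = V (p.1.1, p.2.1) (q.1.1, q.2.1) * V (p.1.2, p.2.2) (q.1.2, q.2.2) := rfl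

theorem twoCopy_conjTranspose (V : Matrix (n × n) (n × n) ℂ) :
    (twoCopy V)ᴴ = twoCopy Vᴴ := by
  ext p q
  simp [twoCopy_apply]

theorem twoCopy_kronecker (A B : Matrix n n ℂ) : twoCopy (A ⊗ₖ B) = (A ⊗ₖ A) ⊗ₖ (B ⊗ₖ B) := by
  ext p q
  simp only [twoCopy_apply, Matrix.kroneckerMap_apply]
  ring

section

variable [DecidableEq n]

theorem twoCopy_one : twoCopy (1 : Matrix (n × n) (n × n) ℂ) = 1 := by
  rw [twoCopy, Matrix.one_kronecker_one, Matrix.submatrix_one_equiv]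

/-- The product `P_s ⊗ P_t` of symmetry projections on the two subsystems. -/
noncomputable def biProj (n : Type*) [DecidableEq n] (s t : Bool) :
    Matrix ((n × n) × (n × n)) ((n × n) × (n × n)) ℂ := symProj n s ⊗ₖ symProj n t

theorem sum_biProj : biProj n true true + biProj n true false + biProj n false true +
    biProj n false false = 1 := by
  simp only [biProj]
  rw [← Matrix.kronecker_add, add_assoc, ← Matrix.kronecker_add, symProj_add,
    ← Matrix.add_kronecker, symProj_add, Matrix.one_kronecker_one]

theorem flip_kronecker_flip_eq :
    flipMatrix n ⊗ₖ flipMatrix n = (flipMatrix (n × n)).submatrix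
      (Equiv.prodProdProdComm n n n n) (Equiv.prodProdProdComm n n n n) := by
  ext ⟨⟨a, b⟩, c, d⟩ ⟨⟨e, f⟩, g, h⟩
  simp only [Matrix.kroneckerMap_apply, flipMatrix_apply, Matrix.submatrix_apply,
    Equiv.prodProdProdComm_apply, Prod.swap_prod_mk, Prod.mk.injEq]
  rw [ite_zero_mul_ite_zero, mul_one]
  congr 1
  simp only [eq_iff_iff]
  tauto

theorem flip_kronecker_one :
    flipMatrix n ⊗ₖ (1 : Matrix (n × n) (n × n) ℂ) = biProj n true true + biProj n true false -
      biProj n false true - biProj n false false := by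
  rw [← symProj_sub, ← symProj_add]
  ext p q
  simp only [Matrix.kroneckerMap_apply, Matrix.add_apply, Matrix.sub_apply, biProj]
  ring

theorem one_kronecker_flip :
    (1 : Matrix (n × n) (n × n) ℂ) ⊗ₖ flipMatrix n = biProj n true true - biProj n true false +
      biProj n false true - biProj n false false := by
  rw [← symProj_sub, ← symProj_add]
  ext p q
  simp only [Matrix.kroneckerMap_apply, Matrix.add_apply, Matrix.sub_apply, biProj]
  ring

end

variable [Fintype n]

theorem twoCopy_mul (V W : Matrix (n × n) (n × n) ℂ) : twoCopy (V * W) = twoCopy V * twoCopy W := by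
  rw [twoCopy, twoCopy, twoCopy, Matrix.submatrix_mul_equiv, Matrix.mul_kronecker_mul]

variable [DecidableEq n]

theorem twoCopy_mul_conjTranspose {V : Matrix (n × n) (n × n) ℂ}
    (hV : V ∈ Matrix.unitaryGroup (n × n) ℂ) : twoCopy V * (twoCopy V)ᴴ = 1 := by
  rw [twoCopy_conjTranspose, ← twoCopy_mul, ← Matrix.star_eq_conjTranspose,
    Unitary.mul_star_self_of_mem hV, twoCopy_one]

theorem conjTranspose_mul_twoCopy {V : Matrix (n × n) (n × n) ℂ}
    (hV : V ∈ Matrix.unitaryGroup (n × n) ℂ) : (twoCopy V)ᴴ * twoCopy V = 1 := by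
  rw [twoCopy_conjTranspose, ← twoCopy_mul, ← Matrix.star_eq_conjTranspose,
    Unitary.star_mul_self_of_mem hV, twoCopy_one]

/-- Flipping both A A and B B exchanges the two whole copies, which carry the same operator. This is
the conservation law behind the selection rule. -/
theorem flip_kronecker_flip_mul_twoCopy (V : Matrix (n × n) (n × n) ℂ) :
    (flipMatrix n ⊗ₖ flipMatrix n) * twoCopy V = twoCopy V * (flipMatrix n ⊗ₖ flipMatrix n) := by
  rw [flip_kronecker_flip_eq, twoCopy, Matrix.submatrix_mul_equiv, Matrix.submatrix_mul_equiv,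
    kronecker_self_commute_flipMatrix]

theorem biProj_trace (s t : Bool) : (biProj n s t).trace = symDim n s * symDim n t := by
  rw [biProj, Matrix.trace_kronecker, symProj_trace, symProj_trace]

theorem flip_kronecker_flip_mul_biProj (s t : Bool) :
    (flipMatrix n ⊗ₖ flipMatrix n) * biProj n s t = (symSign s * symSign t) • biProj n s t := by
  rw [biProj, ← Matrix.mul_kronecker_mul, flipMatrix_mul_symProj, flipMatrix_mul_symProj,
    Matrix.smul_kronecker, Matrix.kronecker_smul, smul_smul]

theorem biProj_mul_flip_kronecker_flip (s t : Bool) :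
    biProj n s t * (flipMatrix n ⊗ₖ flipMatrix n) = (symSign s * symSign t) • biProj n s t := by
  have h := congrArg Matrix.conjTranspose (flip_kronecker_flip_mul_biProj (n := n) s t)
  have hs : ∀ s, star (symSign s) = symSign s := by intro s; cases s <;> simp [symSign]
  rw [Matrix.conjTranspose_mul, Matrix.conjTranspose_smul, star_mul', hs, hs] at h
  simpa only [biProj, Matrix.conjTranspose_kronecker, symProj_conjTranspose,
    flipMatrix_conjTranspose] using h

/-- The overlap `tr (V₂ X V₂ᴴ Y)` with `V₂` two copies of `V`. -/
noncomputable def overlap (V : Matrix (n × n) (n × n) ℂ)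
    (X Y : Matrix ((n × n) × (n × n)) ((n × n) × (n × n)) ℂ) : ℂ :=
  (twoCopy V * X * (twoCopy V)ᴴ * Y).trace

end TwoCopy

/-! ### Selection rule, sum rules and the local average. -/

section Overlap

variable {n : Type*} [Fintype n] (V : Matrix (n × n) (n × n) ℂ)
  (X X' Y Y' : Matrix ((n × n) × (n × n)) ((n × n) × (n × n)) ℂ)

theorem overlap_add_left : overlap V (X + X') Y = overlap V X Y + overlap V X' Y := by
  simp [overlap, Matrix.mul_add, Matrix.add_mul]

theorem overlap_sub_left : overlap V (X - X') Y = overlap V X Y - overlap V X' Y := by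
  simp [overlap, Matrix.mul_sub, Matrix.sub_mul]

theorem overlap_add_right : overlap V X (Y + Y') = overlap V X Y + overlap V X Y' := by
  simp [overlap, Matrix.mul_add]

theorem overlap_sub_right : overlap V X (Y - Y') = overlap V X Y - overlap V X Y' := by
  simp [overlap, Matrix.mul_sub]

variable [DecidableEq n] {V}

/-- The conserved exchange of copies has eigenvalue `symSign a * symSign b` on one projection and
`symSign c * symSign d` on the other; inserting it into the trace shows that distinct eigenvalues
have zero overlap. -/
theorem overlap_biProj_eq_zero (a b c d : Bool) (h : symSign a * symSign b ≠ symSign c * symSign d) :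
    overlap V (biProj n a b) (biProj n c d) = 0 := by
  have h1 : (symSign c * symSign d) * overlap V (biProj n a b) (biProj n c d) =
      (symSign a * symSign b) * overlap V (biProj n a b) (biProj n c d) := by
    have h2 : twoCopy V * biProj n a b * (twoCopy V)ᴴ * (flipMatrix n ⊗ₖ flipMatrix n) =
        (symSign a * symSign b) • (twoCopy V * biProj n a b * (twoCopy V)ᴴ) := by
      rw [twoCopy_conjTranspose, Matrix.mul_assoc, ← flip_kronecker_flip_mul_twoCopy,
        ← Matrix.mul_assoc, Matrix.mul_assoc (twoCopy V), biProj_mul_flip_kronecker_flip,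
        Matrix.mul_smul, Matrix.smul_mul]
    rw [overlap, ← smul_eq_mul (symSign c * symSign d), ← smul_eq_mul (symSign a * symSign b),
      ← Matrix.trace_smul, ← Matrix.trace_smul,
      ← Matrix.smul_mul (symSign a * symSign b), ← h2, ← Matrix.mul_smul, ← flip_kronecker_flip_mul_biProj,
      Matrix.mul_assoc _ (flipMatrix n ⊗ₖ flipMatrix n)]
  by_contra h0
  exact h (mul_right_cancel₀ h0 h1).symm

theorem overlap_one_right (hV : V ∈ Matrix.unitaryGroup (n × n) ℂ) : overlap V X 1 = X.trace := by
  rw [overlap, Matrix.mul_one, Matrix.trace_mul_comm, ← Matrix.mul_assoc,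
    conjTranspose_mul_twoCopy hV, Matrix.one_mul]

theorem overlap_one_left (hV : V ∈ Matrix.unitaryGroup (n × n) ℂ) : overlap V 1 Y = Y.trace := by
  rw [overlap, Matrix.mul_one, twoCopy_mul_conjTranspose hV, Matrix.one_mul]

/-- Conjugation by V₂ preserves the trace. Resolve the identity on the right into four projections;
the selection rule kills two of them. -/
theorem overlap_row (hV : V ∈ Matrix.unitaryGroup (n × n) ℂ) (a b : Bool) :
    overlap V (biProj n a b) (biProj n a b) + overlap V (biProj n a b) (biProj n (!a) (!b)) =
      symDim n a * symDim n b := by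
  have h := overlap_one_right (biProj n a b) hV
  rw [← sum_biProj, overlap_add_right, overlap_add_right, overlap_add_right, biProj_trace] at h
  rw [← h]
  have hz := overlap_biProj_eq_zero (n := n) (V := V)
  cases a <;> cases b <;> simp only [Bool.not_true, Bool.not_false]
  · rw [hz false false true false (by norm_num [symSign]),
      hz false false false true (by norm_num [symSign])]
    ring
  · rw [hz false true true true (by norm_num [symSign]),
      hz false true false false (by norm_num [symSign])]
    ring
  · rw [hz true false true true (by norm_num [symSign]),
      hz true false false false (by norm_num [symSign])]
    ring
  · rw [hz true true true false (by norm_num [symSign]),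
      hz true true false true (by norm_num [symSign])]
    ring

/-- Conjugation by V₂ preserves the identity, which is now resolved on the left. -/
theorem overlap_column (hV : V ∈ Matrix.unitaryGroup (n × n) ℂ) (a b : Bool) :
    overlap V (biProj n a b) (biProj n a b) + overlap V (biProj n (!a) (!b)) (biProj n a b) =
      symDim n a * symDim n b := by
  have h := overlap_one_left (biProj n a b) hV
  rw [← sum_biProj, overlap_add_left, overlap_add_left, overlap_add_left, biProj_trace] at h
  rw [← h]
  have hz := overlap_biProj_eq_zero (n := n) (V := V)
  cases a <;> cases b <;> simp only [Bool.not_true, Bool.not_false]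
  · rw [hz true false false false (by norm_num [symSign]),
      hz false true false false (by norm_num [symSign])]
    ring
  · rw [hz true true false true (by norm_num [symSign]),
      hz false false false true (by norm_num [symSign])]
    ring
  · rw [hz true true true false (by norm_num [symSign]),
      hz false false true false (by norm_num [symSign])]
    ring
  · rw [hz true false true true (by norm_num [symSign]),
      hz false true true true (by norm_num [symSign])]
    ring

/-- The local average of the transition from one symmetry type to the opposite one. -/
theorem integral_overlap_local [Nontrivial n] {W : Matrix (n × n) (n × n) ℂ}
    (hW : W ∈ Matrix.unitaryGroup (n × n) ℂ) (a b : Bool) :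
    ∫ w : Matrix.unitaryGroup n ℂ × Matrix.unitaryGroup n ℂ,
      overlap (W * ((w.1 : Matrix n n ℂ) ⊗ₖ (w.2 : Matrix n n ℂ)) * W)
        (biProj n a b) (biProj n (!a) (!b)) ∂((haarUnitary n).prod (haarUnitary n)) =
      overlap W (biProj n a b) (biProj n (!a) (!b)) *
        (2 - overlap W (biProj n a b) (biProj n (!a) (!b)) * (1 / (symDim n a * symDim n b) +
          1 / (symDim n (!a) * symDim n (!b)))) := by
  -- By cyclicity the outer W moves onto the second projection, leaving only the local gate
  -- conjugating between X = W₂ P W₂ᴴ and Y = W₂ᴴ P' W₂.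
  have h1 : ∀ w : Matrix.unitaryGroup n ℂ × Matrix.unitaryGroup n ℂ,
      overlap (W * ((w.1 : Matrix n n ℂ) ⊗ₖ (w.2 : Matrix n n ℂ)) * W)
        (biProj n a b) (biProj n (!a) (!b)) =
      ((((w.1 : Matrix n n ℂ) ⊗ₖ (w.1 : Matrix n n ℂ)) ⊗ₖ
          ((w.2 : Matrix n n ℂ) ⊗ₖ (w.2 : Matrix n n ℂ))) *
            (twoCopy W * biProj n a b * (twoCopy W)ᴴ) *
        (((w.1 : Matrix n n ℂ) ⊗ₖ (w.1 : Matrix n n ℂ)) ⊗ₖ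
          ((w.2 : Matrix n n ℂ) ⊗ₖ (w.2 : Matrix n n ℂ)))ᴴ *
            ((twoCopy W)ᴴ * biProj n (!a) (!b) * twoCopy W)).trace := by
    intro w
    rw [overlap, twoCopy_mul, twoCopy_mul, twoCopy_kronecker, Matrix.conjTranspose_mul,
      Matrix.conjTranspose_mul]
    simp only [Matrix.mul_assoc]
    rw [Matrix.trace_mul_comm]
    simp only [Matrix.mul_assoc]
  simp only [h1]
  rw [integral_trace_local_twirl]
  have h2 : ∀ s t, ((symProj n s ⊗ₖ symProj n t) *
      (twoCopy W * biProj n a b * (twoCopy W)ᴴ)).trace = overlap W (biProj n a b) (biProj n s t) :=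
    fun s t => by rw [Matrix.trace_mul_comm]; rfl
  have h3 : ∀ s t, ((symProj n s ⊗ₖ symProj n t) *
      ((twoCopy W)ᴴ * biProj n (!a) (!b) * twoCopy W)).trace =
        overlap W (biProj n s t) (biProj n (!a) (!b)) := fun s t => by
    rw [overlap, Matrix.trace_mul_comm, Matrix.mul_assoc, Matrix.trace_mul_comm]
    simp only [Matrix.mul_assoc, biProj]
  simp only [h2, h3, Fintype.sum_bool]
  have hd := symDim_ne_zero (n := n)
  have hr := overlap_row hW a b
  have hc := overlap_column hW (!a) (!b)
  simp only [Bool.not_not] at hc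
  have hz := overlap_biProj_eq_zero (n := n) (V := W)
  -- Two routes survive the average: stay (y) and then cross (x), or cross and then stay (z). The
  -- sum rules give y = D − x and z = D' − x.
  have key : ∀ x y z D D' : ℂ, D ≠ 0 → D' ≠ 0 → y + x = D → z + x = D' →
      y * x / D + x * z / D' = x * (2 - x * (1 / D + 1 / D')) := by
    intro x y z D D' hD hD' h h'
    obtain rfl : y = D - x := by rw [← h]; ring
    obtain rfl : z = D' - x := by rw [← h']; ring
    field_simp
    ring
  rw [← key _ _ _ _ _ (mul_ne_zero (hd a) (hd b)) (mul_ne_zero (hd (!a)) (hd (!b))) hr hc]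
  cases a <;> cases b <;> simp only [Bool.not_true, Bool.not_false]
  · rw [hz false false true false (by norm_num [symSign]),
      hz false false false true (by norm_num [symSign])]
    ring
  · rw [hz false true true true (by norm_num [symSign]),
      hz false true false false (by norm_num [symSign])]
    ring
  · rw [hz true false true true (by norm_num [symSign]),
      hz true false false false (by norm_num [symSign])]
    ring
  · rw [hz true true true false (by norm_num [symSign]),
      hz true true false true (by norm_num [symSign])]
    ring

end Overlap

/-! ### Operator entanglement and gate-typicality as overlaps. -/

section OperatorEntanglement

theorem mul_flip_kronecker_one_apply {n m : Type*} [Fintype n] [DecidableEq n]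
    (M : Matrix m ((n × n) × (n × n)) ℂ) (p : m) (q : (n × n) × (n × n)) :
    (M * (flipMatrix n ⊗ₖ (1 : Matrix (n × n) (n × n) ℂ))) p q = M p (q.1.swap, q.2) := by
  rw [Matrix.mul_apply, Finset.sum_eq_single (q.1.swap, q.2)]
  · simp [Matrix.kroneckerMap_apply, flipMatrix_apply]
  · intro b _ hb
    rw [Matrix.kroneckerMap_apply, flipMatrix_apply, Matrix.one_apply, ite_zero_mul_ite_zero,
      if_neg, mul_zero]
    rintro ⟨h1, h2⟩
    exact hb (Prod.ext h1 h2)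
  · simp

theorem overlap_flip_kronecker_one {n : Type*} [Fintype n] [DecidableEq n]
    (V : Matrix (n × n) (n × n) ℂ) (X : Matrix ((n × n) × (n × n)) ((n × n) × (n × n)) ℂ) :
    overlap V X (flipMatrix n ⊗ₖ 1) =
      ∑ p, ∑ r, (twoCopy V * X) p r * star (twoCopy V (p.1.swap, p.2) r) := by
  rw [overlap, Matrix.mul_assoc, Matrix.trace]
  refine Finset.sum_congr rfl fun p _ => ?_
  rw [Matrix.diag_apply, Matrix.mul_apply]
  refine Finset.sum_congr rfl fun r _ => ?_
  rw [mul_flip_kronecker_one_apply, Matrix.conjTranspose_apply]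

/-- Both sides sum the same products of four entries of V and its conjugate: the index contractions
of R Rᴴ R Rᴴ are those produced by swapping A between the copies, before and after V. The bijection
`e` matches the indices. -/
theorem trace_reshuffled_eq_overlap {N : ℕ} (V R : BipartiteMatrix N)
    (hR : R = Matrix.of fun p q => V (p.1, q.1) (p.2, q.2)) :
    ((R * Rᴴ) * (R * Rᴴ)).trace =
      overlap V (flipMatrix (Fin N) ⊗ₖ 1) (flipMatrix (Fin N) ⊗ₖ 1) := by
  rw [overlap_flip_kronecker_one]
  simp only [mul_flip_kronecker_one_apply]
  simp only [twoCopy_apply, Matrix.trace, Matrix.diag_apply, Matrix.mul_apply,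
    Matrix.conjTranspose_apply, Finset.sum_mul_sum]
  rw [← Fintype.sum_prod_type', ← Fintype.sum_prod_type', ← Fintype.sum_prod_type',
    ← Fintype.sum_prod_type']
  let e : ((((Fin N × Fin N) × (Fin N × Fin N)) × (Fin N × Fin N)) × (Fin N × Fin N)) ≃
      ((Fin N × Fin N) × (Fin N × Fin N)) × ((Fin N × Fin N) × (Fin N × Fin N)) :=
    { toFun := fun t => (((t.1.1.1.1, t.1.1.2.1), (t.1.2.1, t.2.1)),
        ((t.1.1.2.2, t.1.1.1.2), (t.1.2.2, t.2.2)))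
      invFun := fun s => ((((s.1.1.1, s.2.1.2), (s.1.1.2, s.2.1.1)), (s.1.2.1, s.2.2.1)),
        (s.1.2.2, s.2.2.2))
      left_inv := fun _ => rfl
      right_inv := fun _ => rfl }
  refine Fintype.sum_equiv e _ _ fun t => ?_
  simp only [e, Equiv.coe_fn_mk, hR, Matrix.of_apply, Prod.swap_prod_mk, star_mul']
  ring

theorem ofReal_opEntanglement {N : ℕ} (V : BipartiteMatrix N) :
    ((opEntanglement V : ℝ) : ℂ) = 1 - 1 / (N : ℂ) ^ 4 *
      overlap V (flipMatrix (Fin N) ⊗ₖ 1) (flipMatrix (Fin N) ⊗ₖ 1) := by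
  obtain ⟨A, B, h⟩ := (exists_isOperatorSchmidt V).choose_spec
  rw [← trace_reshuffled_eq_overlap V _ rfl, ← h.sum_sq_eq rfl, opEntanglement, schmidtCoeff]
  push_cast
  rfl

theorem swapGate_eq_flipMatrix (N : ℕ) : swapGate N = flipMatrix (Fin N) := by
  ext p q
  simp only [swapGate, flipMatrix_apply, Matrix.of_apply, Prod.ext_iff, Prod.fst_swap,
    Prod.snd_swap]

theorem twoCopy_flipMatrix {n : Type*} [DecidableEq n] :
    twoCopy (flipMatrix n) = flipMatrix (n × n) := by
  ext ⟨⟨a, b⟩, c, d⟩ ⟨⟨e, f⟩, g, h⟩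
  simp only [twoCopy_apply, flipMatrix_apply, Prod.swap_prod_mk, Prod.mk.injEq]
  rw [ite_zero_mul_ite_zero, mul_one]
  congr 1
  simp only [eq_iff_iff]
  tauto

theorem flipMatrix_mul_kronecker_mul {n : Type*} [Fintype n] [DecidableEq n] (A B : Matrix n n ℂ) :
    flipMatrix n * (A ⊗ₖ B) * (flipMatrix n)ᴴ = B ⊗ₖ A := by
  rw [flipMatrix_conjTranspose]
  ext p q
  rw [mul_flipMatrix_apply, flipMatrix_mul_apply]
  simp [Matrix.kroneckerMap_apply, mul_comm]

/-- Two copies of the swap gate exchange the A A and B B factors. Hence E(VS) is the overlap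
starting from the flip on B instead of the flip on A. -/
theorem overlap_mul_flipMatrix {n : Type*} [Fintype n] [DecidableEq n]
    (V : Matrix (n × n) (n × n) ℂ) (A B : Matrix (n × n) (n × n) ℂ)
    (Y : Matrix ((n × n) × (n × n)) ((n × n) × (n × n)) ℂ) :
    overlap (V * flipMatrix n) (A ⊗ₖ B) Y = overlap V (B ⊗ₖ A) Y := by
  rw [overlap, twoCopy_mul, twoCopy_flipMatrix, Matrix.conjTranspose_mul, overlap,
    ← flipMatrix_mul_kronecker_mul A B]
  simp only [Matrix.mul_assoc]

theorem ofReal_opEntanglement_swapGate {N : ℕ} :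
    ((opEntanglement (swapGate N) : ℝ) : ℂ) = 1 - 1 / (N : ℂ) ^ 4 * (N : ℂ) ^ 2 := by
  rw [ofReal_opEntanglement, swapGate_eq_flipMatrix, ← Matrix.one_mul (flipMatrix (Fin N)),
    overlap_mul_flipMatrix, Matrix.one_mul, overlap, twoCopy_one, Matrix.one_mul,
    Matrix.conjTranspose_one, Matrix.mul_one, ← Matrix.mul_kronecker_mul, Matrix.one_mul,
    Matrix.mul_one, Matrix.trace_kronecker, flipMatrix_trace, Fintype.card_fin]
  ring

/-- E(V) − E(VS) pairs 1 ⊗ F − F ⊗ 1 = 2 (P₋₊ − P₊₋) with F ⊗ 1, so only the {+−, −+} sector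
contributes. Both ranks there are d₊ d₋, which makes the table symmetric, and E(S) cancels the
constant term. -/
theorem ofReal_gateTypicality {N : ℕ} (hN : 2 ≤ N) {V : BipartiteMatrix N}
    (hV : V ∈ Matrix.unitaryGroup (Fin N × Fin N) ℂ) :
    ((gateTypicality V : ℝ) : ℂ) = 2 * overlap V (biProj (Fin N) true false)
      (biProj (Fin N) false true) / (symDim (Fin N) true * symDim (Fin N) false) := by
  rw [gateTypicality]
  push_cast
  rw [ofReal_opEntanglement_swapGate, ofReal_opEntanglement, ofReal_opEntanglement,
    swapGate_eq_flipMatrix, overlap_mul_flipMatrix, flip_kronecker_one, one_kronecker_flip]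
  simp only [overlap_add_left, overlap_sub_left, overlap_add_right, overlap_sub_right]
  have hz := overlap_biProj_eq_zero (n := Fin N) (V := V)
  rw [hz true false true true (by norm_num [symSign]), hz true false false false (by norm_num [symSign]),
    hz false true true true (by norm_num [symSign]), hz false true false false (by norm_num [symSign])]
  have h1 := overlap_row hV true false
  have h2 := overlap_row hV false true
  have h3 := overlap_column hV true false
  simp only [Bool.not_true, Bool.not_false] at h1 h2 h3
  have hN0 : (N : ℂ) ≠ 0 := by exact_mod_cast (by omega : N ≠ 0)
  have hN1 : (N : ℂ) - 1 ≠ 0 := sub_ne_zero.2 (by exact_mod_cast (by omega : N ≠ 1))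
  have hN2 : (N : ℂ) + 1 ≠ 0 := by exact_mod_cast (Nat.succ_ne_zero N)
  have e1 : overlap V (biProj (Fin N) true false) (biProj (Fin N) true false) =
      symDim (Fin N) true * symDim (Fin N) false -
        overlap V (biProj (Fin N) true false) (biProj (Fin N) false true) := by
    rw [← h1]; ring
  have e3 : overlap V (biProj (Fin N) false true) (biProj (Fin N) true false) =
      overlap V (biProj (Fin N) true false) (biProj (Fin N) false true) := by
    linear_combination h3 - h1
  have e2 : overlap V (biProj (Fin N) false true) (biProj (Fin N) false true) =
      symDim (Fin N) true * symDim (Fin N) false -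
        overlap V (biProj (Fin N) true false) (biProj (Fin N) false true) := by
    linear_combination h2 - e3
  rw [e1, e2, e3]
  have hd : symDim (Fin N) true * symDim (Fin N) false =
      (N : ℂ) ^ 2 * ((N - 1) * (N + 1)) / 4 := by
    simp [symDim, symSign]
    ring
  rw [hd, show (N : ℂ) ^ 2 - 1 = (N - 1) * (N + 1) by ring]
  field_simp
  ring

end OperatorEntanglement

/-! ### Entangling power as an overlap, and its Haar mean. -/

section EntanglingPower

variable {N : ℕ}

/-- Purity is the expectation in two copies of φ of the swap of their A factors; hermiticity of ρ_A
makes it real, so `re` can be dropped. -/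
theorem ofReal_linearEntropy (φ : Fin N × Fin N → ℂ) :
    ((linearEntropy φ : ℝ) : ℂ) = 1 - ∑ p : (Fin N × Fin N) × (Fin N × Fin N),
      φ (p.1.1, p.2.1) * φ (p.1.2, p.2.2) * star (φ (p.1.2, p.2.1) * φ (p.1.1, p.2.2)) := by
  have hherm : (reducedDensity φ)ᴴ = reducedDensity φ := by
    ext i j
    simp [reducedDensity, partialTraceB, vecMulVec_apply, mul_comm]
  have hreal : (starRingEnd ℂ) (reducedDensity φ * reducedDensity φ).trace =
      (reducedDensity φ * reducedDensity φ).trace := by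
    have := Matrix.trace_conjTranspose (reducedDensity φ * reducedDensity φ)
    rw [Matrix.conjTranspose_mul, hherm] at this
    exact this.symm
  rw [linearEntropy]
  push_cast
  rw [Complex.conj_eq_iff_re.1 hreal]
  congr 1
  simp only [Matrix.trace, Matrix.diag_apply, Matrix.mul_apply, reducedDensity, partialTraceB,
    Matrix.of_apply, vecMulVec_apply, Finset.sum_mul_sum, Fintype.sum_prod_type, Pi.star_apply,
    star_mul']
  refine Finset.sum_congr rfl fun i _ => Finset.sum_congr rfl fun j _ =>
    Finset.sum_congr rfl fun k _ => Finset.sum_congr rfl fun l _ => ?_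
  ring

theorem twoCopy_mulVec_tensorSq (V : BipartiteMatrix N) (a b : EuclideanSpace ℂ (Fin N))
    (p : (Fin N × Fin N) × (Fin N × Fin N)) :
    (V *ᵥ productState a b) (p.1.1, p.2.1) * (V *ᵥ productState a b) (p.1.2, p.2.2) =
      ∑ q, twoCopy V p q * (tensorSq a q.1 * tensorSq b q.2) := by
  have h := congrFun (kronecker_self_mulVec_tensorSq V (productState a b))
    (Equiv.prodProdProdComm _ _ _ _ p)
  refine h.symm.trans ?_
  rw [Matrix.mulVec, dotProduct, ← Equiv.sum_comp (Equiv.prodProdProdComm _ _ _ _)]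
  refine Finset.sum_congr rfl fun q _ => ?_
  simp only [twoCopy, Matrix.submatrix_apply, tensorSq, productState,
    Equiv.prodProdProdComm_apply]
  ring

theorem ofReal_linearEntropy_productState (V : BipartiteMatrix N)
    (a b : EuclideanSpace ℂ (Fin N)) :
    ((linearEntropy (V *ᵥ productState a b) : ℝ) : ℂ) =
      1 - ∑ q, ∑ r, (∑ p, twoCopy V p q * star (twoCopy V (p.1.swap, p.2) r)) *
        ((tensorSq a q.1 * star (tensorSq a r.1)) * (tensorSq b q.2 * star (tensorSq b r.2))) := by
  have h2 : ∀ p : (Fin N × Fin N) × (Fin N × Fin N),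
      (V *ᵥ productState a b) (p.1.2, p.2.1) * (V *ᵥ productState a b) (p.1.1, p.2.2) =
      ∑ q, twoCopy V (p.1.swap, p.2) q * (tensorSq a q.1 * tensorSq b q.2) := fun p =>
    twoCopy_mulVec_tensorSq V a b (p.1.swap, p.2)
  rw [ofReal_linearEntropy]
  simp only [twoCopy_mulVec_tensorSq, h2, star_sum, Finset.sum_mul_sum]
  simp only [Finset.sum_mul]
  rw [Finset.sum_comm]
  congr 1
  refine Finset.sum_congr rfl fun q _ => ?_
  rw [Finset.sum_comm]
  refine Finset.sum_congr rfl fun r _ => Finset.sum_congr rfl fun p _ => ?_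
  simp only [star_mul']
  ring

/-- Averaging over the two spheres replaces the projections onto ψ_A ⊗ ψ_A and ψ_B ⊗ ψ_B by P₊/d₊
each; the flip on A then measures the purity. -/
theorem ofReal_entanglingPower_eq_overlap (hN : 2 ≤ N) (V : BipartiteMatrix N) :
    ((entanglingPower V : ℝ) : ℂ) =
      1 - overlap V (biProj (Fin N) true true) (flipMatrix (Fin N) ⊗ₖ 1) /
        (symDim (Fin N) true * symDim (Fin N) true) := by
  have := isProbabilityMeasure_sphereMeasure (N := N) (by omega)
  have hc : ∀ p q, Continuous fun a : Metric.sphere (0 : EuclideanSpace ℂ (Fin N)) 1 =>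
      tensorSq (a : EuclideanSpace ℂ (Fin N)) p *
        star (tensorSq (a : EuclideanSpace ℂ (Fin N)) q) := by
    intro p q
    have h : ∀ i, Continuous fun a : Metric.sphere (0 : EuclideanSpace ℂ (Fin N)) 1 =>
        (a : EuclideanSpace ℂ (Fin N)) i := fun i => by fun_prop
    exact ((h _).mul (h _)).mul ((h _).mul (h _)).star
  have hi := fun p q => integrable_sphereMeasure (hc p q)
  -- The average `⨍` is by definition the integral against the rescaled measure, which is
  -- `sphereMeasure`.
  have he : entanglingPower V = ∫ a, ∫ b, linearEntropy (V *ᵥ productState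
      (a : EuclideanSpace ℂ (Fin N)) (b : EuclideanSpace ℂ (Fin N)))
        ∂(sphereMeasure N) ∂(sphereMeasure N) := rfl
  rw [he, ← integral_complex_ofReal]
  simp only [← integral_complex_ofReal, ofReal_linearEntropy_productState]
  have hb : ∀ a : Metric.sphere (0 : EuclideanSpace ℂ (Fin N)) 1,
      ∫ b, (1 - ∑ q, ∑ r, (∑ p, twoCopy V p q * star (twoCopy V (p.1.swap, p.2) r)) *
        ((tensorSq (a : EuclideanSpace ℂ (Fin N)) q.1 *
          star (tensorSq (a : EuclideanSpace ℂ (Fin N)) r.1)) *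
        (tensorSq (b : EuclideanSpace ℂ (Fin N)) q.2 *
          star (tensorSq (b : EuclideanSpace ℂ (Fin N)) r.2)))) ∂(sphereMeasure N) =
      1 - ∑ q, ∑ r, (∑ p, twoCopy V p q * star (twoCopy V (p.1.swap, p.2) r)) *
        ((tensorSq (a : EuclideanSpace ℂ (Fin N)) q.1 *
          star (tensorSq (a : EuclideanSpace ℂ (Fin N)) r.1)) *
        ((symDim (Fin N) true)⁻¹ * symProj (Fin N) true q.2 r.2)) := by
    intro a
    rw [integral_sub (integrable_const _) (integrable_finsetSum _ fun q _ =>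
        integrable_finsetSum _ fun r _ => ((hi _ _).const_mul _).const_mul _),
      integral_const, probReal_univ, one_smul, integral_finsetSum _ fun q _ =>
        integrable_finsetSum _ fun r _ => ((hi _ _).const_mul _).const_mul _]
    congr 1
    refine Finset.sum_congr rfl fun q _ => ?_
    rw [integral_finsetSum _ fun r _ => ((hi _ _).const_mul _).const_mul _]
    refine Finset.sum_congr rfl fun r _ => ?_
    rw [integral_const_mul, integral_const_mul, integral_tensorSq_mul_star hN]
  simp only [hb]
  rw [integral_sub (integrable_const _) (integrable_finsetSum _ fun q _ =>
      integrable_finsetSum _ fun r _ => ((hi _ _).mul_const _).const_mul _),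
    integral_const, probReal_univ, one_smul, integral_finsetSum _ fun q _ =>
      integrable_finsetSum _ fun r _ => ((hi _ _).mul_const _).const_mul _]
  congr 1
  have hq : ∀ q, ∫ a : Metric.sphere (0 : EuclideanSpace ℂ (Fin N)) 1,
      ∑ r, (∑ p, twoCopy V p q * star (twoCopy V (p.1.swap, p.2) r)) *
        ((tensorSq (a : EuclideanSpace ℂ (Fin N)) q.1 *
          star (tensorSq (a : EuclideanSpace ℂ (Fin N)) r.1)) *
        ((symDim (Fin N) true)⁻¹ * symProj (Fin N) true q.2 r.2)) ∂(sphereMeasure N) =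
      ∑ r, (∑ p, twoCopy V p q * star (twoCopy V (p.1.swap, p.2) r)) *
        (((symDim (Fin N) true)⁻¹ * symProj (Fin N) true q.1 r.1) *
        ((symDim (Fin N) true)⁻¹ * symProj (Fin N) true q.2 r.2)) := by
    intro q
    rw [integral_finsetSum _ fun r _ => ((hi _ _).mul_const _).const_mul _]
    refine Finset.sum_congr rfl fun r _ => ?_
    rw [integral_const_mul, integral_mul_const, integral_tensorSq_mul_star hN]
  simp only [hq]
  rw [overlap_flip_kronecker_one]
  simp only [Matrix.mul_apply, Finset.sum_mul, Finset.sum_div, biProj, Matrix.kroneckerMap_apply]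
  rw [Finset.sum_comm_cycle]
  refine Finset.sum_congr rfl fun p _ => ?_
  rw [Finset.sum_comm]
  refine Finset.sum_congr rfl fun r _ => Finset.sum_congr rfl fun q _ => ?_
  rw [div_eq_mul_inv, mul_inv]
  ring

theorem continuous_overlap {n : Type*} [Fintype n]
    (X Y : Matrix ((n × n) × (n × n)) ((n × n) × (n × n)) ℂ) :
    Continuous fun V : Matrix (n × n) (n × n) ℂ => overlap V X Y := by
  have h : Continuous fun V : Matrix (n × n) (n × n) ℂ => twoCopy V :=
    continuous_matrix fun i j => by
      simp only [twoCopy_apply]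
      fun_prop
  unfold overlap
  fun_prop

/-- On the sector {++, −−} the flip on A is P₊₊ − P₋₋. With x the weight from ++ to −−, the row sum
gives purity (d₊² − 2x)/d₊². -/
theorem ofReal_entanglingPower (hN : 2 ≤ N) {V : BipartiteMatrix N}
    (hV : V ∈ Matrix.unitaryGroup (Fin N × Fin N) ℂ) :
    ((entanglingPower V : ℝ) : ℂ) = 2 * overlap V (biProj (Fin N) true true)
      (biProj (Fin N) false false) / (symDim (Fin N) true * symDim (Fin N) true) := by
  have : Nontrivial (Fin N) := Fin.nontrivial_iff_two_le.2 hN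
  have hz := overlap_biProj_eq_zero (n := Fin N) (V := V)
  have h1 := overlap_row hV true true
  have hd := symDim_ne_zero (n := Fin N) true
  simp only [Bool.not_true] at h1
  rw [ofReal_entanglingPower_eq_overlap hN, flip_kronecker_one]
  simp only [overlap_add_right, overlap_sub_right]
  rw [hz true true true false (by norm_num [symSign]), hz true true false true (by norm_num [symSign]),
    eq_sub_of_add_eq h1]
  field_simp
  ring

/-- This is `integral_trace_twirl` for the N²-dimensional space, transported along the reordering of
factors that turns the flip of whole copies into F ⊗ F. -/
theorem integral_overlap [Nontrivial (Fin N × Fin N)]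
    (X Y : Matrix ((Fin N × Fin N) × (Fin N × Fin N)) ((Fin N × Fin N) × (Fin N × Fin N)) ℂ) :
    ∫ U, overlap (U : BipartiteMatrix N) X Y ∂(haarUnitary (Fin N × Fin N)) =
      ∑ s : Bool, (((1 / 2 : ℂ) • (1 + symSign s • (flipMatrix (Fin N) ⊗ₖ flipMatrix (Fin N)))) * X).trace *
        (((1 / 2 : ℂ) • (1 + symSign s • (flipMatrix (Fin N) ⊗ₖ flipMatrix (Fin N)))) * Y).trace /
          symDim (Fin N × Fin N) s := by
  set σ := Equiv.prodProdProdComm (Fin N) (Fin N) (Fin N) (Fin N) with hσ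
  have htr : ∀ M : Matrix ((Fin N × Fin N) × (Fin N × Fin N)) ((Fin N × Fin N) × (Fin N × Fin N)) ℂ,
      (M.submatrix σ.symm σ.symm).trace = M.trace := fun M =>
    Equiv.sum_comp σ.symm fun i => M i i
  have h1 : ∀ U : BipartiteMatrix N, overlap U X Y = ((U ⊗ₖ U) * X.submatrix σ.symm σ.symm *
      (U ⊗ₖ U)ᴴ * Y.submatrix σ.symm σ.symm).trace := by
    intro U
    have h2 : U ⊗ₖ U = (twoCopy U).submatrix σ.symm σ.symm := rfl
    rw [h2, Matrix.conjTranspose_submatrix, Matrix.submatrix_mul_equiv,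
      Matrix.submatrix_mul_equiv, Matrix.submatrix_mul_equiv, htr, overlap]
  have h3 : ∀ s, symProj (Fin N × Fin N) s =
      ((1 / 2 : ℂ) • (1 + symSign s • (flipMatrix (Fin N) ⊗ₖ flipMatrix (Fin N)))).submatrix
        σ.symm σ.symm := by
    intro s
    rw [flip_kronecker_flip_eq, symProj, Matrix.submatrix_smul, Matrix.submatrix_add,
      Matrix.submatrix_smul]
    simp [← hσ]
  simp only [h1]
  rw [integral_trace_twirl]
  refine Finset.sum_congr rfl fun s _ => ?_
  rw [h3, Matrix.submatrix_mul_equiv, Matrix.submatrix_mul_equiv, htr, htr]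

theorem ofReal_meanEntanglingPower (hN : 2 ≤ N) :
    ((meanEntanglingPower N : ℝ) : ℂ) = ((N : ℂ) - 1) ^ 2 / ((N : ℂ) ^ 2 + 1) := by
  have : Nontrivial (Fin N) := Fin.nontrivial_iff_two_le.2 hN
  have : Nonempty (Fin N) := inferInstance
  have hd := symDim_ne_zero (n := Fin N) true
  rw [meanEntanglingPower, ← integral_complex_ofReal]
  simp only [ofReal_entanglingPower_eq_overlap hN]
  have hi : Integrable (fun U : Matrix.unitaryGroup (Fin N × Fin N) ℂ =>
      overlap (U : BipartiteMatrix N) (biProj (Fin N) true true) (flipMatrix (Fin N) ⊗ₖ 1) /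
        (symDim (Fin N) true * symDim (Fin N) true)) (haarUnitary (Fin N × Fin N)) :=
    integrable_haarUnitary (((continuous_overlap _ _).comp continuous_subtype_val).div_const _)
  rw [integral_sub (integrable_const _) hi,
    integral_const, probReal_univ, one_smul, integral_div, integral_overlap, Fintype.sum_bool]
  -- P₊₊ is fixed by F ⊗ F, so the antisymmetric term vanishes. The traces of F ⊗ 1 and 1 ⊗ F are
  -- both N³, and the mean purity comes out as 2N/(N² + 1).
  simp only [Matrix.smul_mul, Matrix.add_mul, Matrix.one_mul, flip_kronecker_flip_mul_biProj,
    ← Matrix.mul_kronecker_mul, flipMatrix_mul_self, Matrix.mul_one, Matrix.trace_smul,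
    Matrix.trace_add, biProj_trace, Matrix.trace_kronecker, flipMatrix_trace, Matrix.trace_one,
    symDim, symSign, Fintype.card_prod, Fintype.card_fin, smul_eq_mul]
  have hN0 : (N : ℂ) ≠ 0 := by exact_mod_cast (by omega : N ≠ 0)
  have hN2 : (N : ℂ) + 1 ≠ 0 := by exact_mod_cast (Nat.succ_ne_zero N)
  have hN3 : (N : ℂ) ^ 2 + 1 ≠ 0 := by exact_mod_cast (Nat.succ_ne_zero (N ^ 2))
  have hN4 : (N : ℂ) * N + 1 ≠ 0 := by rwa [← sq]
  push_cast
  simp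
  field_simp
  ring

end EntanglingPower

/-! ### From the mean over local gates to the existence of a good one. -/

instance {n : Type*} [Fintype n] [DecidableEq n] :
    SecondCountableTopology (Matrix.unitaryGroup n ℂ) :=
  have : SecondCountableTopology (Matrix n n ℂ) :=
    inferInstanceAs (SecondCountableTopology (n → n → ℂ))
  TopologicalSpace.Subtype.secondCountableTopology _

/-- A continuous function of two independent Haar distributed unitaries reaches its mean. -/
theorem exists_integral_le_of_continuous {n : Type*} [Fintype n] [DecidableEq n]
    {f : Matrix.unitaryGroup n ℂ → Matrix.unitaryGroup n ℂ → ℝ}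
    {g : Matrix n n ℂ → Matrix n n ℂ → ℂ} (hg : Continuous fun w : Matrix n n ℂ × Matrix n n ℂ =>
      g w.1 w.2) (hfg : ∀ u v : Matrix.unitaryGroup n ℂ, (f u v : ℂ) = g u v) {c : ℝ}
    (hc : ∫ w : Matrix.unitaryGroup n ℂ × Matrix.unitaryGroup n ℂ, g w.1 w.2
      ∂((haarUnitary n).prod (haarUnitary n)) = c) :
    ∃ u v, c ≤ f u v := by
  have hf : (fun w : Matrix.unitaryGroup n ℂ × Matrix.unitaryGroup n ℂ => f w.1 w.2) =
      fun w => (g w.1 w.2).re := by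
    ext w
    rw [← hfg, Complex.ofReal_re]
  have hcont : Continuous fun w : Matrix.unitaryGroup n ℂ × Matrix.unitaryGroup n ℂ =>
      f w.1 w.2 := by
    rw [hf]
    exact Complex.continuous_re.comp (hg.comp
      (continuous_subtype_val.prodMap continuous_subtype_val))
  have hint : Integrable (fun w : Matrix.unitaryGroup n ℂ × Matrix.unitaryGroup n ℂ =>
      f w.1 w.2) ((haarUnitary n).prod (haarUnitary n)) :=
    hcont.integrable_of_hasCompactSupport (HasCompactSupport.of_compactSpace _)
  obtain ⟨w, hw⟩ := exists_integral_le hint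
  refine ⟨w.1, w.2, le_trans (le_of_eq ?_) hw⟩
  apply Complex.ofReal_injective
  rw [← integral_complex_ofReal, ← hc]
  simp only [hfg]

theorem corollary1 {N : ℕ} (hN : 2 ≤ N) (U : Matrix.unitaryGroup (Fin N × Fin N) ℂ) :
    (entanglingPower (U : BipartiteMatrix N) <
        entanglingPower (principalSqrt U : BipartiteMatrix N) *
          (2 - entanglingPower (principalSqrt U : BipartiteMatrix N) / meanEntanglingPower N) →
      ∃ UA UB : Matrix.unitaryGroup (Fin N) ℂ,
        entanglingPower (U : BipartiteMatrix N) <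
          entanglingPower ((principalSqrt U : BipartiteMatrix N) * localGate UA UB *
            (principalSqrt U : BipartiteMatrix N))) ∧
    (gateTypicality (U : BipartiteMatrix N) <
        gateTypicality (principalSqrt U : BipartiteMatrix N) *
          (2 - gateTypicality (principalSqrt U : BipartiteMatrix N)) →
      ∃ UA UB : Matrix.unitaryGroup (Fin N) ℂ,
        gateTypicality (U : BipartiteMatrix N) <
          gateTypicality ((principalSqrt U : BipartiteMatrix N) * localGate UA UB *
            (principalSqrt U : BipartiteMatrix N))) := by
  have : Nontrivial (Fin N) := Fin.nontrivial_iff_two_le.2 hN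
  -- The formula for the local average holds for every unitary W.
  generalize principalSqrt U = W
  have hN0 : (N : ℂ) ≠ 0 := by exact_mod_cast (by omega : N ≠ 0)
  have hN1 : (N : ℂ) - 1 ≠ 0 := sub_ne_zero.2 (by exact_mod_cast (by omega : N ≠ 1))
  have hN2 : (N : ℂ) + 1 ≠ 0 := by exact_mod_cast (Nat.succ_ne_zero N)
  have hN3 : (N : ℂ) ^ 2 + 1 ≠ 0 := by exact_mod_cast (Nat.succ_ne_zero (N ^ 2))
  have hdt : symDim (Fin N) true = N * (N + 1) / 2 := by simp [symDim, symSign]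
  have hdf : symDim (Fin N) false = N * (N - 1) / 2 := by simp [symDim, symSign, sub_eq_add_neg]
  have hmem : ∀ u v : Matrix.unitaryGroup (Fin N) ℂ, (W : BipartiteMatrix N) *
      ((u : Matrix (Fin N) (Fin N) ℂ) ⊗ₖ (v : Matrix (Fin N) (Fin N) ℂ)) * (W : BipartiteMatrix N) ∈
        Matrix.unitaryGroup (Fin N × Fin N) ℂ := fun u v =>
    mul_mem (mul_mem W.2 (Matrix.kronecker_mem_unitary u.2 v.2)) W.2
  have hk : Continuous fun w : Matrix (Fin N) (Fin N) ℂ × Matrix (Fin N) (Fin N) ℂ =>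
      w.1 ⊗ₖ w.2 := continuous_matrix fun i j => by
    simp only [Matrix.kroneckerMap_apply]
    fun_prop
  have hcont : ∀ X Y, Continuous fun w : Matrix (Fin N) (Fin N) ℂ × Matrix (Fin N) (Fin N) ℂ =>
      overlap ((W : BipartiteMatrix N) * (w.1 ⊗ₖ w.2) * (W : BipartiteMatrix N)) X Y := fun X Y =>
    (continuous_overlap X Y).comp ((continuous_const.matrix_mul hk).matrix_mul continuous_const)
  constructor
  · intro h
    obtain ⟨u, v, huv⟩ := exists_integral_le_of_continuous
      (f := fun u v => entanglingPower ((W : BipartiteMatrix N) * localGate u v * (W : BipartiteMatrix N)))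
      (g := fun A B => 2 * overlap ((W : BipartiteMatrix N) * (A ⊗ₖ B) * (W : BipartiteMatrix N))
        (biProj (Fin N) true true) (biProj (Fin N) false false) / (symDim (Fin N) true * symDim (Fin N) true))
      (((hcont (biProj (Fin N) true true) (biProj (Fin N) false false)).const_mul 2).div_const
        (symDim (Fin N) true * symDim (Fin N) true))
      (fun u v => ofReal_entanglingPower hN (hmem u v))
      -- The exact mean over local gates: with D = d₊² and D' = d₋², the factor (1 + D/D')/2 is (N²
      -- + 1)/(N − 1)², the reciprocal of the Haar mean.
      (c := entanglingPower (W : BipartiteMatrix N) *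
        (2 - entanglingPower (W : BipartiteMatrix N) / meanEntanglingPower N)) (by
        have := integral_overlap_local W.2 true true
        simp only [Bool.not_true] at this
        rw [integral_div, integral_const_mul, this]
        push_cast
        rw [ofReal_entanglingPower hN W.2, ofReal_meanEntanglingPower hN, hdt, hdf]
        field_simp
        ring)
    exact ⟨u, v, h.trans_le huv⟩
  · intro h
    obtain ⟨u, v, huv⟩ := exists_integral_le_of_continuous
      (f := fun u v => gateTypicality ((W : BipartiteMatrix N) * localGate u v * (W : BipartiteMatrix N)))
      (g := fun A B => 2 * overlap ((W : BipartiteMatrix N) * (A ⊗ₖ B) * (W : BipartiteMatrix N))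
        (biProj (Fin N) true false) (biProj (Fin N) false true) / (symDim (Fin N) true * symDim (Fin N) false))
      (((hcont (biProj (Fin N) true false) (biProj (Fin N) false true)).const_mul 2).div_const
        (symDim (Fin N) true * symDim (Fin N) false))
      (fun u v => ofReal_gateTypicality hN (hmem u v))
      -- Here D = D' = d₊ d₋, so the corresponding factor is 1.
      (c := gateTypicality (W : BipartiteMatrix N) *
        (2 - gateTypicality (W : BipartiteMatrix N))) (by
        have := integral_overlap_local W.2 true false
        simp only [Bool.not_true, Bool.not_false] at this
        rw [integral_div, integral_const_mul, this]
        push_cast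
        rw [ofReal_gateTypicality hN W.2, hdt, hdf]
        field_simp
        ring)
    exact ⟨u, v, h.trans_le huv⟩
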